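/- Let $f:\mathbb{R}^2\to\mathbb{R}^2$ be a $C^\infty$ map and let $\lambda,\sigma\in\mathbb{R}$ satisfy $0<|\lambda|<1$ and $\lambda\sigma=-1$. Let $\mathcal{N}$ be a bounded convex open neighbourhood of the origin on which $$f(x,y)=T_0(x,y)=\Big(\lambda x\big(1+x^2y^2F(x,y)\big),\ -\tfrac1\lambda\, y\big(1+x^2y^2G(x,y)\big)\Big)$$ with $C^\infty$ functions $F,G:\mathcal{N}\to\mathbb{R}$ (that is, $T_0=(\lambda x(1+\mathcal O(x^2y^2)),-\frac1\lambda y(1+\mathcal O(x^2y^2)))$). Let $x^*,y^*>0$ be such that $$(x^*,0),\ (\lambda x^*,0),\ \big(0,\tfrac{y^*}{\sigma}\big),\ \big(0,\tfrac{y^*}{\sigma^2}\big)\in\mathcal{N},$$ let $m\ge1$ be such that $f^m(0,y^*)=(x^*,0)$, and let $T_1=f^m$ have the Taylor expansion $$T_1(x,y)=\begin{bmatrix}x^*+c_1x+c_2(y-y^*)+\mathcal O\big((x,y-y^*)^2\big)\\ d_1x+d_2(y-y^*)+d_3x^2+d_4x(y-y^*)+d_5(y-y^*)^2+\mathcal O\big((x,y-y^*)^3\big)\end{bmatrix}$$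 at $(0,y^*)$. For $\eta>0$ let $\mathcal{N}_\eta=\{(x,y)\in\mathcal{N}: |xy|<\eta\}$. An $\mathrm{SR}_k$-solution is a periodic orbit of $f$ of (least) period $k+m$ with $k$ consecutive points in $\mathcal{N}_\eta$; write $(x_0^{(k)},y_0^{(k)})$ for the first of these. It is asymptotically stable if it is Lyapunov stable and attracts all nearby orbits, and it is a saddle if the derivative of $f^{k+m}$ at $(x_0^{(k)},y_0^{(k)})$ has one eigenvalue of modulus less than $1$ and one of modulus greater than $1$. Suppose $|d_1|=\frac{y^*}{x^*}$, $d_2=0$, $d_5\ne0$, $\Delta>0$, where $$\Delta=\Big(1-\frac{c_2y^*}{x^*}-\frac{d_4y^*}{d_1}\Big)^2-4d_5\big(d_3x^{*2}+c_1d_1x^*\big),$$ and $$-1<\frac{c_2y^*}{x^*}<1-\frac{\sqrt\Delta}{2}.$$ Then for every $\eta>0$ there is $k_{\min}$ such that for all even $k\ge k_{\min}$ in the case $d_1=\frac{y^*}{x^*}$, and for all odd $k\ge k_{\min}$ in the case $d_1=-\frac{y^*}{x^*}$, $f$ has an asymptotically stable $\mathrm{SR}_k$-solution and a saddle $\mathrm{SR}_k$-solution.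 Moreover these solutions can be chosen, independently of $\eta$, so that the points $(x_0^{(k)},y_0^{(k)})$ of both families converge to $(x^*,0)$ as $k\to\infty$. -/

import Mathlib

open Filter Topology
open scoped ContDiff

/-- The partial derivative `∂g/∂x` of a function of two real variables. -/
noncomputable def partialX (g : ℝ × ℝ → ℝ) (p : ℝ × ℝ) : ℝ := fderiv ℝ g p (1, 0)

/-- The partial derivative `∂g/∂y` of a function of two real variables. -/
noncomputable def partialY (g : ℝ × ℝ → ℝ) (p : ℝ × ℝ) : ℝ := fderiv ℝ g p (0, 1)

/-- The set `N_η` of all points `(x, y)` of `N` with `|x y| < η`. -/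
def hyperbolicNhd (N : Set (ℝ × ℝ)) (η : ℝ) : Set (ℝ × ℝ) :=
  {p | p ∈ N ∧ |p.1 * p.2| < η}

/-- `p` is the first of `k` consecutive points in `N_η` of a periodic orbit of `f` whose (least)
period is `k + m`: the orbit of `p` is an `SR_k`-solution. -/
def IsSRSolution (f : ℝ × ℝ → ℝ × ℝ) (N : Set (ℝ × ℝ)) (η : ℝ) (m k : ℕ) (p : ℝ × ℝ) : Prop :=
  0 < k + m ∧ Function.minimalPeriod f p = k + m ∧ ∀ j < k, f^[j] p ∈ hyperbolicNhd N η

/-- The orbit of `p` under `f` is asymptotically stable: it is Lyapunov stable and it attracts the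
orbits of all points sufficiently close to `p`. -/
def IsAsymptoticallyStable (f : ℝ × ℝ → ℝ × ℝ) (p : ℝ × ℝ) : Prop :=
  (∀ ε > 0, ∃ δ > 0, ∀ q, dist q p < δ → ∀ n : ℕ, dist (f^[n] q) (f^[n] p) < ε) ∧
  (∃ δ > 0, ∀ q, dist q p < δ →
    Tendsto (fun n : ℕ => dist (f^[n] q) (f^[n] p)) atTop (𝓝 0))

/-- The point `p`, of period `n`, is a saddle of the planar map `f`: one eigenvalue of the
derivative of `f^n` at `p` lies inside the unit circle and the other lies outside (both are then
real, since non-real eigenvalues of a real 2 by 2 matrix have equal moduli). -/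
def IsSaddle (f : ℝ × ℝ → ℝ × ℝ) (n : ℕ) (p : ℝ × ℝ) : Prop :=
  f^[n] p = p ∧ ∃ μ ν : ℝ, |μ| < 1 ∧ 1 < |ν| ∧
    Module.End.HasEigenvalue (fderiv ℝ (f^[n]) p : ℝ × ℝ →ₗ[ℝ] ℝ × ℝ) μ ∧
    Module.End.HasEigenvalue (fderiv ℝ (f^[n]) p : ℝ × ℝ →ₗ[ℝ] ℝ × ℝ) ν

open Filter Topology
open scoped ContDiff

/-! Put e = λ^k, keep only those k with (-1)^k = s, where s = ±1 satisfies s d₁ x* = y*, and start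
at (x* + e z₁, (-λ)^k (y* + e z₂)). Along the passage near the origin xy has order e, so each
application of T₀ alters the linearised orbit by factors 1 + O(e²). After k steps the deviation is
O(k e²) = o(e), and the orbit arrives at (0, y*) + e (x* + e z₁ + o(e), z₂ + o(1)).

Now apply f^m and undo the scaling. Since d₂ = 0 and s d₁ x* = y*, the terms that would blow up
cancel, and the return map converges in C¹, near any given point, to the generalised Hénon map
(`C1Tendsto.renormalization`) (u, v) ↦ (c₁x* + c₂v, s (d₁u + d₃x*² + d₄x*v + d₅v²)). Its fixed
points solve a quadratic of discriminant Δ. There the determinant is D = -c₂y*/x* and the trace is 1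
+ D ± √Δ. As the trace differs from 1 + D, 1 is not an eigenvalue and both fixed points persist for
large k (`C1Tendsto.exists_fixedPoints`, `exists_SRSolution_family`). The minus sign meets the Jury
conditions, which are exactly the bounds on c₂y*/x*, so `isAsymptoticallyStable_of_jury` applies;
the plus sign gives a saddle by `exists_saddle_eigenvalues`. -/

theorem eventually_prod_nhds_eventually {ι X : Type*} [TopologicalSpace X] {l : Filter ι} {z : X}
    {p : ι × X → Prop} (h : ∀ᶠ q in l ×ˢ 𝓝 z, p q) :
    ∀ᶠ q in l ×ˢ 𝓝 z, ∀ᶠ x in 𝓝 q.2, p (q.1, x) := by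
  obtain ⟨pa, ha, pb, hb, hab⟩ := eventually_prod_iff.1 h
  refine eventually_prod_iff.2 ⟨pa, ha, _, eventually_eventually_nhds.2 hb, ?_⟩
  intro k hk x hx
  filter_upwards [hx] with y hy using hab hk hy

/-! ### C¹ convergence of families of maps and persistence of fixed points -/

section C1Convergence

variable {ι E F G P : Type*} [NormedAddCommGroup E] [NormedSpace ℝ E]
  [NormedAddCommGroup F] [NormedSpace ℝ F] [NormedAddCommGroup G] [NormedSpace ℝ G]
  [NormedAddCommGroup P] [NormedSpace ℝ P] {l : Filter ι}

/-- The maps `g k` and their derivatives converge, locally uniformly near the point `z`, along the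
filter `l`: the limiting value at `z` is `w` and the limiting derivative is `L`. -/
structure C1Tendsto (l : Filter ι) (g : ι → E → F) (z : E) (w : F) (L : E →L[ℝ] F) : Prop where
  tendsto : Tendsto (fun q : ι × E => g q.1 q.2) (l ×ˢ 𝓝 z) (𝓝 w)
  differentiableAt : ∀ᶠ q : ι × E in l ×ˢ 𝓝 z, DifferentiableAt ℝ (g q.1) q.2
  tendsto_fderiv : Tendsto (fun q : ι × E => fderiv ℝ (g q.1) q.2) (l ×ˢ 𝓝 z) (𝓝 L)

namespace C1Tendsto

variable {g : ι → E → F} {z : E} {w : F} {L : E →L[ℝ] F}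

theorem congr (hg : C1Tendsto l g z w L) {g' : ι → E → F}
    (h : ∀ᶠ q : ι × E in l ×ˢ 𝓝 z, g q.1 q.2 = g' q.1 q.2) : C1Tendsto l g' z w L := by
  have h' : ∀ᶠ q : ι × E in l ×ˢ 𝓝 z, g q.1 =ᶠ[𝓝 q.2] g' q.1 :=
    eventually_prod_nhds_eventually h
  refine ⟨hg.tendsto.congr' h, ?_, hg.tendsto_fderiv.congr' ?_⟩
  · filter_upwards [h', hg.differentiableAt] with q h1 h2 using h1.differentiableAt_iff.1 h2
  · filter_upwards [h'] with q h1 using h1.fderiv_eq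

theorem comp {h : ι → F → G} {v : G} {M : F →L[ℝ] G} (hh : C1Tendsto l h w v M)
    (hg : C1Tendsto l g z w L) :
    C1Tendsto l (fun k x => h k (g k x)) z v (M.comp L) := by
  have ht : Tendsto (fun q : ι × E => (q.1, g q.1 q.2)) (l ×ˢ 𝓝 z) (l ×ˢ 𝓝 w) :=
    tendsto_fst.prodMk hg.tendsto
  have hd := ht.eventually hh.differentiableAt
  refine ⟨hh.tendsto.comp ht, ?_, ?_⟩
  · filter_upwards [hd, hg.differentiableAt] with q h1 h2
    exact DifferentiableAt.comp (f := g q.1) (g := h q.1) q.2 h1 h2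
  · have hc := (isBoundedBilinearMap_comp (𝕜 := ℝ) (E := E) (F := F) (G := G)).continuous.tendsto
      (M, L)
    refine (hc.comp ((hh.tendsto_fderiv.comp ht).prodMk_nhds hg.tendsto_fderiv)).congr' ?_
    filter_upwards [hd, hg.differentiableAt] with q h1 h2
    exact (fderiv_comp (f := g q.1) (g := h q.1) q.2 h1 h2).symm

theorem prodMk {h : ι → E → G} {v : G} {M : E →L[ℝ] G} (hg : C1Tendsto l g z w L)
    (hh : C1Tendsto l h z v M) :
    C1Tendsto l (fun k x => (g k x, h k x)) z (w, v) (L.prod M) := by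
  refine ⟨hg.tendsto.prodMk_nhds hh.tendsto, ?_, ?_⟩
  · filter_upwards [hg.differentiableAt, hh.differentiableAt] with q h1 h2 using h1.prodMk h2
  · have hc := (ContinuousLinearMap.prodₗᵢ (𝕜 := ℝ) (E := E) (F := F) (G := G) ℝ).continuous.tendsto
      (L, M)
    refine (hc.comp (hg.tendsto_fderiv.prodMk_nhds hh.tendsto_fderiv)).congr' ?_
    filter_upwards [hg.differentiableAt, hh.differentiableAt] with q h1 h2
    exact (DifferentiableAt.fderiv_prodMk h1 h2).symm

/-- A `C¹` family of maps with a convergent parameter. -/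
theorem of_contDiff {H : P × E → F} (hH : ContDiff ℝ 1 H) {e : ι → P} {p₀ : P}
    (he : Tendsto e l (𝓝 p₀)) (z : E) :
    C1Tendsto l (fun k x => H (e k, x)) z (H (p₀, z))
      (fderiv ℝ (fun x => H (p₀, x)) z) := by
  have ht : Tendsto (fun q : ι × E => (e q.1, q.2)) (l ×ˢ 𝓝 z) (𝓝 (p₀, z)) :=
    (he.comp tendsto_fst).prodMk_nhds tendsto_snd
  have hd : ∀ (p : P) (x : E), HasFDerivAt (fun x => H (p, x))
      ((fderiv ℝ H (p, x)).comp (ContinuousLinearMap.inr ℝ P E)) x := fun p x =>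
    HasFDerivAt.comp (f := fun x => (p, x)) x
      ((hH.differentiable one_ne_zero).differentiableAt.hasFDerivAt) (hasFDerivAt_prodMk_right p x)
  refine ⟨(hH.continuous.tendsto _).comp ht, .of_forall fun q => (hd _ _).differentiableAt, ?_⟩
  rw [(hd p₀ z).fderiv]
  simp_rw [fun q : ι × E => (hd (e q.1) q.2).fderiv]
  have hc : Continuous fun y : P × E =>
      (fderiv ℝ H y).comp (ContinuousLinearMap.inr ℝ P E) :=
    (hH.continuous_fderiv one_ne_zero).clm_comp continuous_const
  exact (hc.tendsto (p₀, z)).comp ht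

/-- A nondegenerate fixed point of the limit persists. -/
theorem exists_fixedPoints [CompleteSpace E] {g : ι → E → E} {L : E →L[ℝ] E}
    (hg : C1Tendsto l g z z L) (A : E ≃L[ℝ] E)
    (hA : (A : E →L[ℝ] E) = L - ContinuousLinearMap.id ℝ E) :
    ∃ x : ι → E, Tendsto x l (𝓝 z) ∧ ∀ᶠ k in l, g k (x k) = x k := by
  rcases subsingleton_or_nontrivial E with hE | hE
  · exact ⟨fun _ => z, tendsto_const_nhds, .of_forall fun k => Subsingleton.elim _ _⟩
  set N : NNReal := ‖(A.symm : E →L[ℝ] E)‖₊ with hN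
  have hNpos : 0 < N := A.nnnorm_symm_pos
  -- This choice makes N⁻¹ - c = c. If g k - id is c-close to A near z, the image of the ball of
  -- radius ‖g k z - z‖ / c covers the ball of radius ‖g k z - z‖ about g k z - z, which contains 0.
  set c : NNReal := N⁻¹ / 2 with hc
  have hcpos : 0 < c := by positivity
  have hcN : ((N : ℝ)⁻¹ - c) = c := by
    rw [hc]; push_cast; ring
  have h1 : ∀ᶠ q : ι × E in l ×ˢ 𝓝 z,
      DifferentiableAt ℝ (g q.1) q.2 ∧ ‖fderiv ℝ (g q.1) q.2 - L‖ ≤ c := by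
    refine hg.differentiableAt.and ?_
    have := hg.tendsto_fderiv.eventually (Metric.closedBall_mem_nhds L (by exact_mod_cast hcpos : (0:ℝ) < c))
    filter_upwards [this] with q hq
    rwa [dist_eq_norm] at hq
  obtain ⟨pa, ha, pb, hb, hab⟩ := eventually_prod_iff.1 h1
  obtain ⟨r, hr, hrb⟩ := Metric.eventually_nhds_iff_ball.1 hb
  have hval : Tendsto (fun k => g k z) l (𝓝 z) := by
    have : Tendsto (fun k => (k, z)) l (l ×ˢ 𝓝 z) :=
      tendsto_id.prodMk tendsto_const_nhds
    exact hg.tendsto.comp this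
  have hdist : Tendsto (fun k => ‖g k z - z‖ / c) l (𝓝 0) := by
    have := (tendsto_iff_norm_sub_tendsto_zero.1 hval).div_const (c : ℝ)
    simpa using this
  have key : ∀ᶠ k in l, ∃ x, dist x z ≤ ‖g k z - z‖ / c ∧ g k x = x := by
    filter_upwards [ha, hdist.eventually (gt_mem_nhds hr)] with k hk hkr
    have happ : ApproximatesLinearOn (fun x => g k x - x) (A : E →L[ℝ] E) (Metric.ball z r) c := by
      intro x hx y hy
      have := (convex_ball z r).norm_image_sub_le_of_norm_hasFDerivWithin_le'
        (f := fun x => g k x - x) (f' := fun x => fderiv ℝ (g k) x - ContinuousLinearMap.id ℝ E)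
        (φ := (A : E →L[ℝ] E)) (C := c) (x := y) (y := x)
        (fun u hu => (((hab hk (hrb u hu)).1.hasFDerivAt).sub (hasFDerivAt_id u)).hasFDerivWithinAt)
        (fun u hu => by
          rw [hA]; simpa using (hab hk (hrb u hu)).2) hy hx
      exact this
    have hs := happ.surjOn_closedBall_of_nonlinearRightInverse A.toNonlinearRightInverse
      (ε := ‖g k z - z‖ / c) (b := z) (by positivity) (Metric.closedBall_subset_ball hkr)
    have hmem : (0 : E) ∈ Metric.closedBall (g k z - z)
        ((((A.toNonlinearRightInverse).nnnorm : ℝ)⁻¹ - c) * (‖g k z - z‖ / c)) := by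
      have : ((A.toNonlinearRightInverse).nnnorm : ℝ) = N := rfl
      rw [this, hcN, mul_div_cancel₀ _ (by exact_mod_cast hcpos.ne'), Metric.mem_closedBall,
        dist_zero_left]
    obtain ⟨x, hx, hx0⟩ := hs hmem
    exact ⟨x, hx, sub_eq_zero.1 hx0⟩
  classical
  refine ⟨fun k => if h : ∃ x, dist x z ≤ ‖g k z - z‖ / c ∧ g k x = x then h.choose else z, ?_, ?_⟩
  · rw [tendsto_iff_dist_tendsto_zero]
    refine squeeze_zero (fun _ => dist_nonneg) (fun k => ?_) hdist
    split_ifs with h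
    · exact h.choose_spec.1
    · rw [dist_self]; positivity
  · filter_upwards [key] with k hk
    simp only [hk, dite_true]
    exact hk.choose_spec.2

end C1Tendsto

end C1Convergence

/-! ### Linear maps of the plane and stability criteria -/

section PlanarMaps

/-- The trace of a linear map of the plane. -/
def planeTrace (L : ℝ × ℝ →L[ℝ] ℝ × ℝ) : ℝ := (L (1, 0)).1 + (L (0, 1)).2

/-- The determinant of a linear map of the plane. -/
def planeDet (L : ℝ × ℝ →L[ℝ] ℝ × ℝ) : ℝ :=
  (L (1, 0)).1 * (L (0, 1)).2 - (L (0, 1)).1 * (L (1, 0)).2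

theorem continuous_planeTrace : Continuous planeTrace := by
  unfold planeTrace; fun_prop

theorem continuous_planeDet : Continuous planeDet := by
  unfold planeDet; fun_prop

theorem plane_apply (L : ℝ × ℝ →L[ℝ] ℝ × ℝ) (v : ℝ × ℝ) :
    L v = (v.1 * (L (1, 0)).1 + v.2 * (L (0, 1)).1, v.1 * (L (1, 0)).2 + v.2 * (L (0, 1)).2) := by
  have : v = v.1 • ((1, 0) : ℝ × ℝ) + v.2 • ((0, 1) : ℝ × ℝ) := by ext <;> simp
  conv_lhs => rw [this, map_add, map_smul, map_smul]
  ext <;> simp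

theorem cayleyHamilton_plane (L : ℝ × ℝ →L[ℝ] ℝ × ℝ) :
    L * L = planeTrace L • L - planeDet L • 1 := by
  refine ContinuousLinearMap.ext fun v => ?_
  change L (L v) = planeTrace L • L v - planeDet L • v
  rw [plane_apply L (L v), plane_apply L v]
  unfold planeTrace planeDet
  ext <;> simp <;> ring

theorem hasEigenvalue_plane (L : ℝ × ℝ →L[ℝ] ℝ × ℝ) (μ : ℝ)
    (h : μ ^ 2 - planeTrace L * μ + planeDet L = 0) :
    Module.End.HasEigenvalue (L : ℝ × ℝ →ₗ[ℝ] ℝ × ℝ) μ := by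
  obtain ⟨v, hv0, hv⟩ : ∃ v : ℝ × ℝ, v ≠ 0 ∧ L v = μ • v := by
    unfold planeTrace planeDet at h
    set a := (L (1, 0)).1 with ha
    set c := (L (1, 0)).2 with hc
    set b := (L (0, 1)).1 with hb
    set d := (L (0, 1)).2 with hd
    have hL : ∀ v : ℝ × ℝ, L v = (v.1 * a + v.2 * b, v.1 * c + v.2 * d) := plane_apply L
    by_cases h1 : b = 0 ∧ μ = a
    · by_cases h2 : c = 0 ∧ μ = d
      · refine ⟨(1, 0), by simp, ?_⟩
        rw [hL]; ext <;> simp [h1.2, h2.1]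
      · refine ⟨(μ - d, c), ?_, ?_⟩
        · simp only [ne_eq, Prod.mk_eq_zero, not_and]
          intro h3 h4; exact h2 ⟨h4, by linarith⟩
        · rw [hL]; ext
          · simp only [Prod.smul_fst, smul_eq_mul]; nlinarith [h1.1, h1.2]
          · simp only [Prod.smul_snd, smul_eq_mul]; ring
    · refine ⟨(b, μ - a), ?_, ?_⟩
      · simp only [ne_eq, Prod.mk_eq_zero, not_and]
        intro h3 h4; exact h1 ⟨h3, by linarith⟩
      · rw [hL]; ext
        · simp only [Prod.smul_fst, smul_eq_mul]; ring
        · simp only [Prod.smul_snd, smul_eq_mul]; linear_combination -h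
  exact Module.End.hasEigenvalue_of_hasEigenvector
    ⟨Module.End.mem_eigenspace_iff.2 hv, hv0⟩

/-- Trace and determinant do not change under conjugation by a diagonal map. -/
theorem planeTrace_planeDet_of_diagonal_conj (L M : ℝ × ℝ →L[ℝ] ℝ × ℝ) (a b : ℝ) (ha : a ≠ 0)
    (hb : b ≠ 0)
    (h : ∀ v : ℝ × ℝ, M (a * v.1, b * v.2) = (a * (L v).1, b * (L v).2)) :
    planeTrace M = planeTrace L ∧ planeDet M = planeDet L := by
  have h1 := h (1, 0)
  have h2 := h (0, 1)
  rw [plane_apply M] at h1 h2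
  simp only [Prod.mk.injEq, mul_one, mul_zero, zero_mul, add_zero, zero_add] at h1 h2
  have e1 : (M (1, 0)).1 = (L (1, 0)).1 := mul_left_cancel₀ ha h1.1
  have e2 : (M (0, 1)).2 = (L (0, 1)).2 := mul_left_cancel₀ hb h2.2
  refine ⟨by unfold planeTrace; rw [e1, e2], ?_⟩
  unfold planeDet
  rw [e1, e2]
  have e3 : a * b * ((M (0, 1)).1 * (M (1, 0)).2) = a * b * ((L (0, 1)).1 * (L (1, 0)).2) := by
    linear_combination (M (1, 0)).2 * a * h2.1 + a * (L (0, 1)).1 * h1.2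
  have := mul_left_cancel₀ (mul_ne_zero ha hb) e3
  linarith

/-- The characteristic polynomial is negative at 1 and positive at -1, so one root lies in (-1, 1)
and the other beyond 1. -/
theorem exists_saddle_eigenvalues {τ D : ℝ} (h1 : 1 + D < τ) (h2 : 0 < 1 + τ + D) :
    ∃ μ ν : ℝ, |μ| < 1 ∧ 1 < |ν| ∧ μ ^ 2 - τ * μ + D = 0 ∧ ν ^ 2 - τ * ν + D = 0 := by
  have hdisc : 0 ≤ τ ^ 2 - 4 * D := by
    nlinarith [sq_nonneg (τ - 2), sq_nonneg (τ + 2)]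
  set w := √(τ ^ 2 - 4 * D) with hw
  have hw2 : w ^ 2 = τ ^ 2 - 4 * D := Real.sq_sqrt hdisc
  have hw0 : 0 ≤ w := Real.sqrt_nonneg _
  have hτ : 0 < τ := by linarith
  have hwlo : |τ - 2| < w := abs_lt_of_sq_lt_sq (by nlinarith) hw0
  have hwhi : w < τ + 2 := lt_of_pow_lt_pow_left₀ 2 (by linarith) (by nlinarith)
  rw [abs_lt] at hwlo
  refine ⟨(τ - w) / 2, (τ + w) / 2, ?_, ?_, by nlinarith, by nlinarith⟩
  · rw [abs_lt]; constructor <;> linarith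
  · exact lt_of_lt_of_le (by linarith) (le_abs_self _)

/-- The Schur-Cohn (Jury) stability criterion for a quadratic polynomial. -/
theorem norm_root_lt_one_of_jury {τ D : ℝ} (h1 : |τ| < 1 + D) (h2 : D < 1) {r : ℂ}
    (hr : r ^ 2 - τ * r + D = 0) : ‖r‖ < 1 := by
  rw [abs_lt] at h1
  have hre := congrArg Complex.re hr
  have him := congrArg Complex.im hr
  simp [pow_two] at hre him
  have hn : ‖r‖ ^ 2 = r.re ^ 2 + r.im ^ 2 := by
    rw [Complex.sq_norm, Complex.normSq_apply]; ring
  have hn0 := norm_nonneg r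
  suffices h : r.re ^ 2 + r.im ^ 2 < 1 by nlinarith
  -- A real root is confined by positivity of the polynomial at ±1 and D < 1; a non-real root has
  -- squared modulus D.
  by_cases h0 : r.im = 0
  · rw [h0] at hre ⊢
    have hlt : |r.re| < 1 := by
      rw [abs_lt]
      constructor
      · by_contra! hc
        nlinarith
      · by_contra! hc
        nlinarith
    have := sq_lt_one_iff_abs_lt_one r.re |>.2 hlt
    linarith
  · have : 2 * r.re = τ := by
      have : r.im * (2 * r.re - τ) = 0 := by linarith
      rcases mul_eq_zero.1 this with h | h
      · exact absurd h h0
      · linarith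
    nlinarith

/-- By Cayley-Hamilton the powers of L are combinations of L and 1, with coefficients from a scalar
recurrence that has the same characteristic polynomial. The bound (n + 1) ρ^n on its solution covers
real, complex and repeated roots alike. -/
theorem tendsto_pow_zero_of_jury (L : ℝ × ℝ →L[ℝ] ℝ × ℝ)
    (h1 : |planeTrace L| < 1 + planeDet L) (h2 : planeDet L < 1) :
    Tendsto (fun n : ℕ => L ^ n) atTop (𝓝 0) := by
  set τ := planeTrace L with hτ
  set D := planeDet L with hD
  obtain ⟨r, hr⟩ : ∃ r : ℂ, r ^ 2 - τ * r + D = 0 := by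
    obtain ⟨w, hw⟩ := IsAlgClosed.exists_pow_nat_eq ((τ : ℂ) ^ 2 - 4 * D) (n := 2) (by norm_num)
    exact ⟨(τ + w) / 2, by linear_combination hw / 4⟩
  have hr' : ((τ : ℂ) - r) ^ 2 - τ * (τ - r) + D = 0 := by linear_combination hr
  have hn1 := norm_root_lt_one_of_jury h1 h2 hr
  have hn2 := norm_root_lt_one_of_jury h1 h2 hr'
  set ρ := max ‖r‖ ‖(τ : ℂ) - r‖ with hρ
  have hρ1 : ρ < 1 := max_lt hn1 hn2
  have hρ0 : 0 ≤ ρ := le_max_of_le_left (norm_nonneg r)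
  let a : ℕ → ℝ := fun n => Nat.rec (motive := fun _ => ℝ × ℝ) (0, 1)
    (fun _ p => (p.2, τ * p.2 - D * p.1)) n |>.1
  have ha0 : a 0 = 0 := rfl
  have ha1 : a 1 = 1 := rfl
  have ha2 : ∀ n, a (n + 2) = τ * a (n + 1) - D * a n := fun n => rfl
  have hpow : ∀ n, L ^ (n + 1) = a (n + 1) • L - (D * a n) • (1 : ℝ × ℝ →L[ℝ] ℝ × ℝ) := by
    intro n
    induction n with
    | zero => simp [ha0, ha1]
    | succ n ih =>
      rw [pow_succ, ih, sub_mul, smul_mul_assoc, cayleyHamilton_plane L, ha2, smul_mul_assoc,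
        one_mul]
      module
  -- Splitting off the root r leaves a first order recurrence governed by the other root τ - r.
  have hgeom : ∀ n, (a (n + 1) : ℂ) - r * a n = (τ - r) ^ n := by
    intro n
    induction n with
    | zero => simp [ha0, ha1]
    | succ n ih =>
      rw [ha2, pow_succ, ← ih]; push_cast
      linear_combination -(a n : ℂ) * hr
  have hbound : ∀ n, |a (n + 1)| ≤ (n + 1) * ρ ^ n := by
    intro n
    induction n with
    | zero => simp [ha1]
    | succ n ih =>
      have e : (a (n + 1 + 1) : ℂ) = r * a (n + 1) + (τ - r) ^ (n + 1) := by
        linear_combination hgeom (n + 1)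
      have e2 : |a (n + 1 + 1)| ≤ ‖r‖ * |a (n + 1)| + ‖(τ : ℂ) - r‖ ^ (n + 1) := by
        have := congrArg norm e
        rw [Complex.norm_real, Real.norm_eq_abs] at this
        rw [this]
        refine (norm_add_le _ _).trans ?_
        rw [norm_mul, norm_pow, Complex.norm_real, Real.norm_eq_abs]
      have e3 : ‖r‖ * |a (n + 1)| ≤ ρ * ((n + 1) * ρ ^ n) :=
        mul_le_mul (le_max_left _ _) ih (abs_nonneg _) hρ0
      have e4 : ‖(τ : ℂ) - r‖ ^ (n + 1) ≤ ρ ^ (n + 1) :=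
        pow_le_pow_left₀ (norm_nonneg _) (le_max_right _ _) _
      calc _ ≤ _ := e2
        _ ≤ ρ * ((n + 1) * ρ ^ n) + ρ ^ (n + 1) := add_le_add e3 e4
        _ = _ := by push_cast; ring
  have hb : Tendsto (fun n : ℕ => ((n : ℝ) + 1) * ρ ^ n) atTop (𝓝 0) := by
    have t1 := tendsto_self_mul_const_pow_of_lt_one hρ0 hρ1
    have t2 := tendsto_pow_atTop_nhds_zero_of_lt_one hρ0 hρ1
    simpa [add_mul] using t1.add t2
  have ht1 : Tendsto (fun n => a (n + 1)) atTop (𝓝 0) :=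
    squeeze_zero_norm hbound hb
  have ht : Tendsto a atTop (𝓝 0) := (tendsto_add_atTop_iff_nat 1).1 ht1
  refine (tendsto_add_atTop_iff_nat 1).1 ?_
  simp_rw [hpow]
  simpa using (ht1.smul_const L).sub
    ((ht.const_mul D).smul_const (1 : ℝ × ℝ →L[ℝ] ℝ × ℝ))

/-- Some power of the derivative has norm below 1/4; allowing another 1/4 for the Taylor remainder,
f^M halves distances to p nearby. The leftover i % M iterates are handled by continuity. -/
theorem isAsymptoticallyStable_of_jury {f : ℝ × ℝ → ℝ × ℝ} (hf : Differentiable ℝ f)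
    {n : ℕ} (hn : 0 < n) {p : ℝ × ℝ} (hp : f^[n] p = p)
    (h1 : |planeTrace (fderiv ℝ f^[n] p)| < 1 + planeDet (fderiv ℝ f^[n] p))
    (h2 : planeDet (fderiv ℝ f^[n] p) < 1) : IsAsymptoticallyStable f p := by
  set L := fderiv ℝ f^[n] p with hL
  have hd : HasFDerivAt f^[n] L p := ((hf.iterate n) p).hasFDerivAt
  obtain ⟨j, hj, hj0⟩ : ∃ j : ℕ, ‖L ^ j‖ < 1 / 4 ∧ 0 < j := by
    have := (tendsto_pow_zero_of_jury L h1 h2).norm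
    rw [norm_zero] at this
    exact ((this.eventually (gt_mem_nhds (by norm_num))).and (eventually_gt_atTop 0)).exists
  set M := n * j with hM
  have hMpos : 0 < M := Nat.mul_pos hn hj0
  have hdM : HasFDerivAt f^[M] (L ^ j) p := by
    rw [hM, Function.iterate_mul]; exact hd.iterate hp j
  have hpM : f^[M] p = p := by
    rw [hM, Function.iterate_mul]; exact Function.iterate_fixed hp j
  obtain ⟨r, hr, hcontr⟩ : ∃ r > 0, ∀ q, dist q p < r → dist (f^[M] q) p ≤ dist q p / 2 := by
    have := (hasFDerivAt_iff_isLittleO_nhds_zero.1 hdM).def (show (0 : ℝ) < 1 / 4 by norm_num)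
    obtain ⟨r, hr, h⟩ := Metric.eventually_nhds_iff.1 this
    refine ⟨r, hr, fun q hq => ?_⟩
    have h' := h (y := q - p) (by rwa [dist_zero_right, ← dist_eq_norm])
    rw [add_sub_cancel, hpM] at h'
    rw [dist_eq_norm, dist_eq_norm]
    have h3 : ‖(L ^ j) (q - p)‖ ≤ 1 / 4 * ‖q - p‖ :=
      ((L ^ j).le_opNorm _).trans (by gcongr)
    calc ‖f^[M] q - p‖ = ‖(f^[M] q - p - (L ^ j) (q - p)) + (L ^ j) (q - p)‖ := by
          rw [sub_add_cancel]
      _ ≤ 1 / 4 * ‖q - p‖ + 1 / 4 * ‖q - p‖ := (norm_add_le _ _).trans (add_le_add h' h3)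
      _ = _ := by ring
  have hiter : ∀ i q, dist q p < r → dist (f^[M * i] q) p ≤ dist q p * (1 / 2) ^ i := by
    intro i q hq
    induction i with
    | zero => simp
    | succ i ih =>
      have hlt : dist (f^[M * i] q) p < r := by
        refine ih.trans_lt (lt_of_le_of_lt ?_ hq)
        exact mul_le_of_le_one_right dist_nonneg (pow_le_one₀ (by norm_num) (by norm_num))
      rw [Nat.mul_succ, Nat.add_comm, Function.iterate_add_apply]
      refine (hcontr _ hlt).trans ?_
      rw [pow_succ]; linarith
  have hsplit : ∀ i q, f^[i] q = f^[i % M] (f^[M * (i / M)] q) := by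
    intro i q
    rw [← Function.iterate_add_apply, Nat.mod_add_div]
  have hsplitp : ∀ i, f^[M * i] p = p := by
    intro i; rw [Function.iterate_mul]; exact Function.iterate_fixed hpM i
  have hcont : ∀ ε > 0, ∃ δ > 0, ∀ q, dist q p < δ → ∀ i < M, dist (f^[i] q) (f^[i] p) < ε := by
    intro ε hε
    have : ∀ᶠ q in 𝓝 p, ∀ i ∈ Set.Iio M, dist (f^[i] q) (f^[i] p) < ε := by
      rw [eventually_all_finite (Set.finite_Iio M)]
      intro i _
      exact Metric.tendsto_nhds.1 ((hf.continuous.iterate i).tendsto p) ε hε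
    obtain ⟨δ, hδ, h⟩ := Metric.eventually_nhds_iff.1 this
    exact ⟨δ, hδ, fun q hq i hi => h hq i hi⟩
  constructor
  · intro ε hε
    obtain ⟨δ, hδ, h⟩ := hcont ε hε
    refine ⟨min δ r, lt_min hδ hr, fun q hq i => ?_⟩
    rw [hsplit i q, hsplit i p, hsplitp]
    refine h _ ?_ _ (Nat.mod_lt _ hMpos)
    refine (hiter _ q (hq.trans_le (min_le_right _ _))).trans_lt
      (lt_of_le_of_lt ?_ (hq.trans_le (min_le_left _ _)))
    exact mul_le_of_le_one_right dist_nonneg (pow_le_one₀ (by norm_num) (by norm_num))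
  · refine ⟨r, hr, fun q hq => ?_⟩
    rw [Metric.tendsto_atTop]
    intro ε hε
    obtain ⟨δ, hδ, h⟩ := hcont ε hε
    have hlim : Tendsto (fun i : ℕ => dist q p * (1 / 2 : ℝ) ^ (i / M)) atTop (𝓝 0) := by
      have t := (tendsto_pow_atTop_nhds_zero_of_lt_one (r := (1 / 2 : ℝ)) (by norm_num)
        (by norm_num)).comp (Nat.tendsto_div_const_atTop hMpos.ne')
      simpa using t.const_mul (dist q p)
    obtain ⟨n₀, hn₀⟩ := eventually_atTop.1 (hlim.eventually (gt_mem_nhds hδ))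
    refine ⟨n₀, fun i hi => ?_⟩
    rw [Real.dist_0_eq_abs, abs_of_nonneg dist_nonneg, hsplit i q, hsplit i p, hsplitp]
    exact h _ ((hiter _ q hq).trans_lt (hn₀ i hi)) _ (Nat.mod_lt _ hMpos)

end PlanarMaps

/-! ### Rescaled Taylor expansions -/

section ScaledTaylor

variable {ι E F : Type*} [NormedAddCommGroup E] [NormedSpace ℝ E] [NormedAddCommGroup F]
  [NormedSpace ℝ F] {l : Filter ι} {e : ι → ℝ}

theorem tendsto_differenceQuotient {φ : E → F} {φ' : E →L[ℝ] F} {p : E} (h : HasFDerivAt φ φ' p)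
    (he : Tendsto e l (𝓝 0)) (he0 : ∀ᶠ k in l, e k ≠ 0) (z : E) :
    Tendsto (fun q : ι × E => (e q.1)⁻¹ • (φ (p + e q.1 • q.2) - φ p)) (l ×ˢ 𝓝 z)
      (𝓝 (φ' z)) := by
  have hw := h.hasFDerivWithinAt (s := Set.univ)
  refine hw.lim ?_ (Eventually.of_forall fun _ => Set.mem_univ _) ?_
  · have := (he.comp tendsto_fst).smul (tendsto_snd (f := l) (g := 𝓝 z))
    simpa using this
  · refine (tendsto_snd (f := l) (g := 𝓝 z)).congr' ?_
    filter_upwards [tendsto_fst.eventually he0] with q hq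
    rw [smul_smul, inv_mul_cancel₀ hq, one_smul]

/-- By symmetry of the second derivative, the derivative of the remainder is the first order
remainder of `fderiv ℝ g`, hence o(‖h‖). The mean value inequality on the ball of radius ‖h‖ gains
the second power. -/
theorem taylor_second_order_isLittleO {g : E → ℝ} (hg : ContDiff ℝ 2 g) (p : E) :
    (fun h : E => g (p + h) - g p - fderiv ℝ g p h - fderiv ℝ (fderiv ℝ g) p h h / 2)
      =o[𝓝 0] fun h => ‖h‖ ^ 2 := by
  have hd1 : Differentiable ℝ g := hg.differentiable (by norm_num)
  have hd2 : HasFDerivAt (fderiv ℝ g) (fderiv ℝ (fderiv ℝ g) p) p :=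
    ((hg.fderiv_right (m := 1) (by norm_num)).differentiable (by norm_num) p).hasFDerivAt
  set B := fderiv ℝ (fderiv ℝ g) p with hB
  have hsymm : ∀ v w, B v w = B w v := by
    have := hg.contDiffAt.isSymmSndFDerivAt (x := p) (by simp)
    exact fun v w => this v w
  set r : E → ℝ := fun h => g (p + h) - g p - fderiv ℝ g p h - B h h / 2 with hr
  have hrd : ∀ h, HasFDerivAt r (fderiv ℝ g (p + h) - fderiv ℝ g p - B h) h := by
    intro h
    have a1 : HasFDerivAt (fun h => g (p + h)) (fderiv ℝ g (p + h)) h := by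
      exact (HasFDerivAt.comp (f := fun h => p + h) h (hd1 (p + h)).hasFDerivAt
        ((hasFDerivAt_id h).const_add p)).congr_fderiv (by ext v; simp)
    have a2 : HasFDerivAt (fun h => B h h) (B h + B.flip h) h := by
      have := B.hasFDerivAt (x := h) |>.clm_apply (hasFDerivAt_id h)
      simpa using this
    have a3 := ((a1.sub_const (g p)).sub (fderiv ℝ g p).hasFDerivAt).sub (a2.const_mul (1 / 2))
    refine (a3.congr_fderiv ?_).congr_of_eventuallyEq (.of_forall fun x => ?_)
    · ext v
      simp [hsymm v h]; ring
    · simp only [hr, Pi.sub_apply]; ring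
  have hr0 : r 0 = 0 := by simp [hr]
  refine Asymptotics.isLittleO_iff.2 fun c hc => ?_
  have hlo := (hasFDerivAt_iff_isLittleO_nhds_zero.1 hd2).def hc
  obtain ⟨δ, hδ, hb⟩ := Metric.eventually_nhds_iff.1 hlo
  refine Metric.eventually_nhds_iff.2 ⟨δ, hδ, fun h hh => ?_⟩
  rw [dist_zero_right] at hh
  have := (convex_closedBall (0 : E) ‖h‖).norm_image_sub_le_of_norm_hasFDerivWithin_le
    (f := r) (C := c * ‖h‖) (x := 0) (y := h) (fun x _ => (hrd x).hasFDerivWithinAt)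
    (fun x hx => by
      rw [mem_closedBall_zero_iff] at hx
      refine (hb (y := x) (by rw [dist_zero_right]; exact hx.trans_lt hh)).trans ?_
      gcongr) (by simp) (by simp)
  rw [hr0, sub_zero, sub_zero] at this
  rw [norm_pow, norm_norm]
  calc ‖r h‖ ≤ _ := this
    _ = _ := by ring

theorem hasFDerivAt_comp_add_smul {g : E → F} (hg : Differentiable ℝ g) (p : E) (a : ℝ) (z : E) :
    HasFDerivAt (fun z => g (p + a • z)) (a • fderiv ℝ g (p + a • z)) z := by
  have := HasFDerivAt.comp (f := fun z => p + a • z) z (hg (p + a • z)).hasFDerivAt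
    (((hasFDerivAt_id z).const_smul a).const_add p)
  exact this.congr_fderiv (by ext v; simp)

theorem C1Tendsto.rescaled_first_order {g : E → ℝ} (hg : ContDiff ℝ 1 g) (p : E)
    (he : Tendsto e l (𝓝 0)) (he0 : ∀ᶠ k in l, e k ≠ 0) (z : E) :
    C1Tendsto l (fun k z => (e k)⁻¹ * (g (p + e k • z) - g p)) z (fderiv ℝ g p z)
      (fderiv ℝ g p) := by
  have hd : Differentiable ℝ g := hg.differentiable one_ne_zero
  have hder : ∀ (a : ℝ) (z : E), HasFDerivAt (fun z => a⁻¹ * (g (p + a • z) - g p))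
      (a⁻¹ • (a • fderiv ℝ g (p + a • z))) z := fun a z =>
    ((hasFDerivAt_comp_add_smul hd p a z).sub_const _).const_mul _
  refine ⟨tendsto_differenceQuotient (hd p).hasFDerivAt he he0 z,
    .of_forall fun q => (hder _ _).differentiableAt, ?_⟩
  simp_rw [fun q : ι × E => (hder (e q.1) q.2).fderiv]
  have ht : Tendsto (fun q : ι × E => p + e q.1 • q.2) (l ×ˢ 𝓝 z) (𝓝 p) := by
    have := ((he.comp tendsto_fst).smul (tendsto_snd (f := l) (g := 𝓝 z))).const_add p
    simpa using this
  refine (((hg.continuous_fderiv one_ne_zero).tendsto p).comp ht).congr' ?_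
  filter_upwards [tendsto_fst.eventually he0] with q hq
  simp [smul_smul, inv_mul_cancel₀ hq]

/-- The values converge by Taylor's formula. The derivatives are difference quotients of `fderiv ℝ
g`, which is differentiable at p. -/
theorem C1Tendsto.rescaled_second_order {g : E → ℝ} (hg : ContDiff ℝ 2 g) (p : E)
    (he : Tendsto e l (𝓝 0)) (he0 : ∀ᶠ k in l, e k ≠ 0) (z : E) :
    C1Tendsto l (fun k z => (e k ^ 2)⁻¹ * (g (p + e k • z) - g p - e k * fderiv ℝ g p z)) z
      (fderiv ℝ (fderiv ℝ g) p z z / 2) (fderiv ℝ (fderiv ℝ g) p z) := by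
  have hd : Differentiable ℝ g := hg.differentiable (by norm_num)
  have hd2 : HasFDerivAt (fderiv ℝ g) (fderiv ℝ (fderiv ℝ g) p) p :=
    ((hg.fderiv_right (m := 1) (by norm_num)).differentiable (by norm_num) p).hasFDerivAt
  have hder : ∀ (a : ℝ) (z : E),
      HasFDerivAt (fun z => (a ^ 2)⁻¹ * (g (p + a • z) - g p - a * fderiv ℝ g p z))
      ((a ^ 2)⁻¹ • (a • fderiv ℝ g (p + a • z) - a • fderiv ℝ g p)) z := fun a z =>
    (((hasFDerivAt_comp_add_smul hd p a z).sub_const _).sub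
      ((fderiv ℝ g p).hasFDerivAt.const_mul a)).const_mul _
  refine ⟨?_, .of_forall fun q => (hder _ _).differentiableAt, ?_⟩
  · set B := fderiv ℝ (fderiv ℝ g) p with hB
    have ht : Tendsto (fun q : ι × E => e q.1 • q.2) (l ×ˢ 𝓝 z) (𝓝 0) := by
      have := (he.comp tendsto_fst).smul (tendsto_snd (f := l) (g := 𝓝 z))
      simpa using this
    have hlo := (taylor_second_order_isLittleO hg p).comp_tendsto ht
    have hB2 : Tendsto (fun q : ι × E => B q.2 q.2 / 2) (l ×ˢ 𝓝 z) (𝓝 (B z z / 2)) := by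
      have : Continuous fun z => B z z / 2 := by fun_prop
      exact (this.tendsto z).comp tendsto_snd
    have hrem : Tendsto (fun q : ι × E => (e q.1 ^ 2)⁻¹ * (g (p + e q.1 • q.2) - g p -
        fderiv ℝ g p (e q.1 • q.2) - B (e q.1 • q.2) (e q.1 • q.2) / 2)) (l ×ˢ 𝓝 z) (𝓝 0) := by
      have hO : (fun q : ι × E => (e q.1 ^ 2)⁻¹ * ‖e q.1 • q.2‖ ^ 2) =O[l ×ˢ 𝓝 z]
          fun _ => (1 : ℝ) := by
        have : Tendsto (fun q : ι × E => ‖q.2‖ ^ 2) (l ×ˢ 𝓝 z) (𝓝 (‖z‖ ^ 2)) :=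
          (tendsto_snd.norm).pow 2
        refine (this.isBigO_one ℝ).congr' ?_ .rfl
        filter_upwards [tendsto_fst.eventually he0] with q hq
        rw [norm_smul, mul_pow, Real.norm_eq_abs, sq_abs, inv_mul_cancel_left₀ (pow_ne_zero 2 hq)]
      have := ((Asymptotics.isBigO_refl (fun q : ι × E => (e q.1 ^ 2)⁻¹) (l ×ˢ 𝓝 z)).mul_isLittleO
        hlo).trans_isBigO hO
      exact (Asymptotics.isLittleO_one_iff ℝ).1 this
    have hsum := hrem.add hB2
    rw [zero_add] at hsum
    refine hsum.congr' ?_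
    filter_upwards [tendsto_fst.eventually he0] with q hq
    simp only [map_smul, smul_eq_mul, FunLike.coe_smul, Pi.smul_apply]
    field_simp
    ring
  · simp_rw [fun q : ι × E => (hder (e q.1) q.2).fderiv]
    refine (tendsto_differenceQuotient hd2 he he0 z).congr' ?_
    filter_upwards [tendsto_fst.eventually he0] with q hq
    rw [← smul_sub, smul_smul]
    congr 1
    field_simp

end ScaledTaylor

/-- Multiplication by a cut-off equal to 1 near K. It makes F and G globally smooth, as the slow
recurrence requires, without changing them near the orbits that matter. -/
theorem exists_contDiff_extension {E : Type*} [NormedAddCommGroup E] [NormedSpace ℝ E]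
    [FiniteDimensional ℝ E] {N K : Set E} (hN : IsOpen N) (hK : IsCompact K) (hKN : K ⊆ N)
    {F : E → ℝ} (hF : ContDiffOn ℝ ∞ F N) :
    ∃ F' : E → ℝ, ContDiff ℝ ∞ F' ∧ ∃ U : Set E, IsOpen U ∧ K ⊆ U ∧ Set.EqOn F' F U := by
  obtain ⟨K', hK', hKK', hK'N⟩ := exists_compact_between hK hN hKN
  obtain ⟨χ, h1, h0, -⟩ := exists_contMDiffMap_one_nhds_of_subset_interior (n := ⊤)
    (modelWithCornersSelf ℝ E) hK.isClosed hKK'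
  have hχ : ContDiff ℝ ∞ χ := χ.contMDiff.contDiff
  refine ⟨fun x => χ x * F x, contDiff_iff_contDiffAt.2 fun x => ?_, ?_⟩
  · by_cases hx : x ∈ N
    · exact hχ.contDiffAt.mul (hF.contDiffAt (hN.mem_nhds hx))
    · have hx' : x ∈ K'ᶜ := fun h => hx (hK'N h)
      refine (contDiffAt_const (c := (0 : ℝ))).congr_of_eventuallyEq ?_
      filter_upwards [hK'.isClosed.isOpen_compl.mem_nhds hx'] with y hy
      rw [h0 y hy, zero_mul]
  · obtain ⟨U, hU, hKU, hU1⟩ := mem_nhdsSet_iff_exists.1 h1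
    refine ⟨U, hU, hKU, fun x hx => ?_⟩
    have : χ x = 1 := hU1 hx
    simp [this]

/-! ### Recurrences with small steps -/

section SlowIteration

variable {P E W : Type*} [NormedAddCommGroup P] [NormedSpace ℝ P]
  [NormedAddCommGroup E] [NormedSpace ℝ E] [NormedAddCommGroup W] [NormedSpace ℝ W]

/-- The solution of `w (j + 1) = w j + δ • H (q j, z, w j)`, as a function of `z`. -/
def slowIterate (H : P × E × W → W) (w₀ : W) (q : ℕ → P) (δ : ℝ) : ℕ → E → W
  | 0, _ => w₀
  | j + 1, z => slowIterate H w₀ q δ j z + δ • H (q j, z, slowIterate H w₀ q δ j z)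

variable {H : P × E × W → W} (hH : ContDiff ℝ 1 H) (w₀ : W)

include hH in
theorem hasFDerivAt_slowIterate_succ (q : ℕ → P) (δ : ℝ) (j : ℕ) (z : E)
    (h : DifferentiableAt ℝ (slowIterate H w₀ q δ j) z) :
    HasFDerivAt (slowIterate H w₀ q δ (j + 1))
      (fderiv ℝ (slowIterate H w₀ q δ j) z +
        δ • (fderiv ℝ H (q j, z, slowIterate H w₀ q δ j z)).comp
          ((0 : E →L[ℝ] P).prod ((ContinuousLinearMap.id ℝ E).prod
            (fderiv ℝ (slowIterate H w₀ q δ j) z)))) z := by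
  have h1 : HasFDerivAt (fun z => (q j, z, slowIterate H w₀ q δ j z)) ((0 : E →L[ℝ] P).prod
      ((ContinuousLinearMap.id ℝ E).prod (fderiv ℝ (slowIterate H w₀ q δ j) z))) z :=
    (hasFDerivAt_const (q j) z).prodMk ((hasFDerivAt_id z).prodMk h.hasFDerivAt)
  exact h.hasFDerivAt.add (((hH.differentiable one_ne_zero _).hasFDerivAt.comp z h1).const_smul δ)

include hH in
theorem differentiable_slowIterate (q : ℕ → P) (δ : ℝ) (j : ℕ) :
    Differentiable ℝ (slowIterate H w₀ q δ j) := by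
  induction j with
  | zero => exact differentiable_const w₀
  | succ j ih => exact fun z =>
      (hasFDerivAt_slowIterate_succ hH w₀ q δ j z (ih z)).differentiableAt

variable [ProperSpace P] [ProperSpace E] [ProperSpace W]

include hH in
-- While C k δ ≤ 1 the iterates stay in the unit ball about w₀, where C bounds H and its derivative;
-- each step then adds at most C δ to both quantities.
theorem exists_bound_slowIterate (z₀ : E) :
    ∃ C : ℝ, 0 ≤ C ∧ ∀ z ∈ Metric.closedBall z₀ 1, ∀ q : ℕ → P, (∀ j, ‖q j‖ ≤ 1) →
      ∀ δ : ℝ, 0 ≤ δ → ∀ k : ℕ, C * (k * δ) ≤ 1 → ∀ j ≤ k,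
        ‖slowIterate H w₀ q δ j z - w₀‖ ≤ C * (j * δ) ∧
        ‖fderiv ℝ (slowIterate H w₀ q δ j) z‖ ≤ C * (j * δ) := by
  set K : Set (P × E × W) :=
    Metric.closedBall 0 1 ×ˢ Metric.closedBall z₀ 1 ×ˢ Metric.closedBall w₀ 1 with hK
  have hKc : IsCompact K := (isCompact_closedBall _ _).prod
    ((isCompact_closedBall _ _).prod (isCompact_closedBall _ _))
  obtain ⟨C₁, hC₁⟩ := hKc.exists_bound_of_continuousOn hH.continuous.continuousOn
  obtain ⟨C₂, hC₂⟩ := hKc.exists_bound_of_continuousOn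
    (hH.continuous_fderiv one_ne_zero).continuousOn
  set C := max 0 (max C₁ C₂) with hC
  have hC0 : 0 ≤ C := le_max_left _ _
  refine ⟨C, hC0, fun z hz q hq δ hδ k hk j => ?_⟩
  induction j with
  | zero =>
    intro _
    have : slowIterate H w₀ q δ 0 = fun _ => w₀ := rfl
    simp [this]
  | succ j ih =>
    intro hj
    obtain ⟨ih1, ih2⟩ := ih (by omega)
    have hjk : C * (j * δ) ≤ 1 := by
      refine le_trans ?_ hk
      have : (j : ℝ) ≤ k := by exact_mod_cast (by omega : j ≤ k)
      gcongr
    have hmem : (q j, z, slowIterate H w₀ q δ j z) ∈ K :=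
      ⟨by simpa using hq j, hz, by
        rw [Metric.mem_closedBall, dist_eq_norm]; exact ih1.trans hjk⟩
    have b1 : ‖H (q j, z, slowIterate H w₀ q δ j z)‖ ≤ C :=
      (hC₁ _ hmem).trans ((le_max_left _ _).trans (le_max_right _ _))
    have b2 : ‖fderiv ℝ H (q j, z, slowIterate H w₀ q δ j z)‖ ≤ C :=
      (hC₂ _ hmem).trans ((le_max_right _ _).trans (le_max_right _ _))
    have hsum : C * (j * δ) + δ * C = C * ((j + 1 : ℕ) * δ) := by push_cast; ring
    rw [← hsum]
    constructor
    · have : slowIterate H w₀ q δ (j + 1) z - w₀ = (slowIterate H w₀ q δ j z - w₀) +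
          δ • H (q j, z, slowIterate H w₀ q δ j z) := by
        rw [slowIterate]; abel
      rw [this]
      refine (norm_add_le _ _).trans (add_le_add ih1 ?_)
      rw [norm_smul, Real.norm_of_nonneg hδ]
      gcongr
    · rw [(hasFDerivAt_slowIterate_succ hH w₀ q δ j z
        (differentiable_slowIterate hH w₀ q δ j z)).fderiv]
      refine (norm_add_le _ _).trans (add_le_add ih2 ?_)
      rw [norm_smul, Real.norm_of_nonneg hδ]
      refine mul_le_mul_of_nonneg_left ?_ hδ
      refine (ContinuousLinearMap.opNorm_comp_le _ _).trans ?_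
      -- In the sup norm a derivative of norm at most 1 does not enlarge the product, so no
      -- exponential growth factor appears.
      have b3 : ‖(0 : E →L[ℝ] P).prod ((ContinuousLinearMap.id ℝ E).prod
          (fderiv ℝ (slowIterate H w₀ q δ j) z))‖ ≤ 1 := by
        rw [ContinuousLinearMap.opNorm_prod, Prod.norm_mk, ContinuousLinearMap.opNorm_prod,
          Prod.norm_mk, norm_zero]
        exact max_le zero_le_one (max_le ContinuousLinearMap.norm_id_le (ih2.trans hjk))
      calc _ ≤ C * 1 := mul_le_mul b2 b3 (norm_nonneg _) hC0
        _ = C := mul_one C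

variable {l : Filter ℕ} {e : ℕ → ℝ} {q : ℕ → ℕ → P}

include hH in
theorem eventually_slowIterate_bound (hq : ∀ k j, ‖q k j‖ ≤ 1) (he : Tendsto e l (𝓝 0))
    (hke : Tendsto (fun k : ℕ => k * e k) l (𝓝 0)) (z₀ : E) :
    ∃ C : ℝ, 0 ≤ C ∧ ∀ᶠ p : ℕ × E in l ×ˢ 𝓝 z₀, ∀ j ≤ p.1,
      ‖slowIterate H w₀ (q p.1) (e p.1 ^ 2) j p.2 - w₀‖ ≤ C * (p.1 * e p.1 ^ 2) ∧
      ‖fderiv ℝ (slowIterate H w₀ (q p.1) (e p.1 ^ 2) j) p.2‖ ≤ C * (p.1 * e p.1 ^ 2) := by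
  obtain ⟨C, hC0, hC⟩ := exists_bound_slowIterate hH w₀ z₀
  refine ⟨C, hC0, ?_⟩
  have ht : Tendsto (fun k : ℕ => C * (k * e k ^ 2)) l (𝓝 0) := by
    have := (hke.mul he).const_mul C
    simp only [mul_zero] at this
    refine this.congr fun k => by ring
  have hz : ∀ᶠ z in 𝓝 z₀, z ∈ Metric.closedBall z₀ 1 := Metric.closedBall_mem_nhds _ one_pos
  filter_upwards [tendsto_fst.eventually (ht.eventually (ge_mem_nhds one_pos)),
    tendsto_snd.eventually hz] with p h1 h2 j hj
  have h3 := hC p.2 h2 (q p.1) (hq p.1) (e p.1 ^ 2) (sq_nonneg _) p.1 h1 j hj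
  have h4 : C * (j * e p.1 ^ 2) ≤ C * (p.1 * e p.1 ^ 2) := by
    have : (j : ℝ) ≤ p.1 := by exact_mod_cast hj
    gcongr
  exact ⟨h3.1.trans h4, h3.2.trans h4⟩

include hH in
theorem eventually_slowIterate_near (hq : ∀ k j, ‖q k j‖ ≤ 1) (he : Tendsto e l (𝓝 0))
    (hke : Tendsto (fun k : ℕ => k * e k) l (𝓝 0)) (z₀ : E) {r : ℝ} (hr : 0 < r) :
    ∀ᶠ p : ℕ × E in l ×ˢ 𝓝 z₀, ∀ j ≤ p.1,
      ‖slowIterate H w₀ (q p.1) (e p.1 ^ 2) j p.2 - w₀‖ < r := by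
  obtain ⟨C, -, hC⟩ := eventually_slowIterate_bound hH w₀ hq he hke z₀
  have ht : Tendsto (fun k : ℕ => C * (k * e k ^ 2)) l (𝓝 0) := by
    have := (hke.mul he).const_mul C
    simp only [mul_zero] at this
    refine this.congr fun k => by ring
  filter_upwards [hC, tendsto_fst.eventually (ht.eventually (gt_mem_nhds hr))] with p h1 h2 j hj
  exact (h1 j hj).1.trans_lt h2

include hH in
-- The deviation O(k e²), divided by e, is O(k e) and still vanishes; the same holds for the
-- derivative.
theorem C1Tendsto.slowIterate_rescaled (hq : ∀ k j, ‖q k j‖ ≤ 1) (he : Tendsto e l (𝓝 0))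
    (hke : Tendsto (fun k : ℕ => k * e k) l (𝓝 0)) (z₀ : E) :
    C1Tendsto l (fun k z => (e k)⁻¹ • (slowIterate H w₀ (q k) (e k ^ 2) k z - w₀)) z₀ 0 0 := by
  obtain ⟨C, hC0, hC⟩ := eventually_slowIterate_bound hH w₀ hq he hke z₀
  have hder : ∀ k z, HasFDerivAt
      (fun z => (e k)⁻¹ • (slowIterate H w₀ (q k) (e k ^ 2) k z - w₀))
      ((e k)⁻¹ • fderiv ℝ (slowIterate H w₀ (q k) (e k ^ 2) k) z) z := fun k z =>
    ((differentiable_slowIterate hH w₀ (q k) (e k ^ 2) k z).hasFDerivAt.sub_const w₀).const_smul _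
  have ht : Tendsto (fun p : ℕ × E => C * |p.1 * e p.1|) (l ×ˢ 𝓝 z₀) (𝓝 0) := by
    have := (hke.abs.const_mul C).comp (tendsto_fst (f := l) (g := 𝓝 z₀))
    rwa [abs_zero, mul_zero] at this
  have hle : ∀ k : ℕ, |(e k)⁻¹| * (C * (k * e k ^ 2)) ≤ C * |k * e k| := by
    intro k
    by_cases h0 : e k = 0
    · simp [h0]
    · rw [abs_inv, abs_mul, Nat.abs_cast, ← sq_abs (e k)]
      have : |e k| ≠ 0 := abs_ne_zero.2 h0
      exact le_of_eq (by field_simp)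
  refine ⟨?_, .of_forall fun p => (hder _ _).differentiableAt, ?_⟩
  · refine squeeze_zero_norm' ?_ ht
    filter_upwards [hC] with p hp
    rw [norm_smul, Real.norm_eq_abs]
    exact (mul_le_mul_of_nonneg_left (hp p.1 le_rfl).1 (abs_nonneg _)).trans (hle _)
  · simp_rw [fun p : ℕ × E => (hder p.1 p.2).fderiv]
    refine squeeze_zero_norm' ?_ ht
    filter_upwards [hC] with p hp
    rw [norm_smul, Real.norm_eq_abs]
    exact (mul_le_mul_of_nonneg_left (hp p.1 le_rfl).2 (abs_nonneg _)).trans (hle _)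

end SlowIteration

/-! ### The passage near the origin -/

section LocalOrbit

/-- The increments of the factors by which an orbit of `T₀` deviates from an orbit of the
linearised map, as a function of the parameters `(a, b, e)`, the rescaled initial point `(u, v)`
and the factors `(P, Q)` themselves. -/
def factorIncrement (F G : ℝ × ℝ → ℝ) (xs ys : ℝ) (t : (ℝ × ℝ × ℝ) × (ℝ × ℝ) × (ℝ × ℝ)) : ℝ × ℝ :=
  (((xs + t.1.2.2 * t.2.1.1) * t.2.2.1 * ((ys + t.1.2.2 * t.2.1.2) * t.2.2.2)) ^ 2 *
    F (t.1.1 * ((xs + t.1.2.2 * t.2.1.1) * t.2.2.1),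
      t.1.2.1 * ((ys + t.1.2.2 * t.2.1.2) * t.2.2.2)) * t.2.2.1,
   ((xs + t.1.2.2 * t.2.1.1) * t.2.2.1 * ((ys + t.1.2.2 * t.2.1.2) * t.2.2.2)) ^ 2 *
    G (t.1.1 * ((xs + t.1.2.2 * t.2.1.1) * t.2.2.1),
      t.1.2.1 * ((ys + t.1.2.2 * t.2.1.2) * t.2.2.2)) * t.2.2.2)

theorem contDiff_factorIncrement {F G : ℝ × ℝ → ℝ} (hF : ContDiff ℝ 1 F) (hG : ContDiff ℝ 1 G)
    (xs ys : ℝ) : ContDiff ℝ 1 (factorIncrement F G xs ys) := by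
  unfold factorIncrement
  fun_prop

/-- The factors by which the first `j` of `k` iterates of `T₀` deviate from the linear ones. -/
noncomputable def localFactors (F G : ℝ × ℝ → ℝ) (lam xs ys : ℝ) (k j : ℕ) (z : ℝ × ℝ) : ℝ × ℝ :=
  slowIterate (factorIncrement F G xs ys) (1, 1) (fun j => (lam ^ j, (-lam) ^ (k - j), lam ^ k))
    ((lam ^ k) ^ 2) j z

/-- The first coordinate of an orbit of `T₀`, divided by `λ ^ j`. -/
noncomputable def amplitudeX (F G : ℝ × ℝ → ℝ) (lam xs ys : ℝ) (k j : ℕ) (z : ℝ × ℝ) : ℝ :=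
  (xs + lam ^ k * z.1) * (localFactors F G lam xs ys k j z).1

/-- The second coordinate of an orbit of `T₀`, multiplied by `σ ^ (k - j)`. -/
noncomputable def amplitudeY (F G : ℝ × ℝ → ℝ) (lam xs ys : ℝ) (k j : ℕ) (z : ℝ × ℝ) : ℝ :=
  (ys + lam ^ k * z.2) * (localFactors F G lam xs ys k j z).2

/-- The orbit of `T₀` that starts at the point with rescaled coordinates `z`. -/
noncomputable def localOrbit (F G : ℝ × ℝ → ℝ) (lam xs ys : ℝ) (k j : ℕ) (z : ℝ × ℝ) : ℝ × ℝ :=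
  (lam ^ j * amplitudeX F G lam xs ys k j z, (-lam) ^ (k - j) * amplitudeY F G lam xs ys k j z)

/-- The affine change of coordinates near `(xs, 0)`. -/
def rescaling (lam xs ys : ℝ) (k : ℕ) (z : ℝ × ℝ) : ℝ × ℝ :=
  (xs + lam ^ k * z.1, (-lam) ^ k * (ys + lam ^ k * z.2))

variable (F G : ℝ × ℝ → ℝ) (lam xs ys : ℝ)

theorem localOrbit_zero (k : ℕ) (z : ℝ × ℝ) :
    localOrbit F G lam xs ys k 0 z = rescaling lam xs ys k z := by
  simp [localOrbit, rescaling, amplitudeX, amplitudeY, localFactors, slowIterate]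

/-- Since λ^j and (-λ)^(k-j) have product ±λ^k, the term x²y² of T₀ carries exactly the step size
(λ^k)² of the recurrence for the factors. -/
theorem localOrbit_succ (hlam : lam ≠ 0) {k j : ℕ} (hj : j < k) (z : ℝ × ℝ) :
    localOrbit F G lam xs ys k (j + 1) z =
      (lam * (localOrbit F G lam xs ys k j z).1 *
        (1 + (localOrbit F G lam xs ys k j z).1 ^ 2 * (localOrbit F G lam xs ys k j z).2 ^ 2 *
          F (localOrbit F G lam xs ys k j z)),
       -(1 / lam) * (localOrbit F G lam xs ys k j z).2 *
        (1 + (localOrbit F G lam xs ys k j z).1 ^ 2 * (localOrbit F G lam xs ys k j z).2 ^ 2 *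
          G (localOrbit F G lam xs ys k j z))) := by
  obtain ⟨i, rfl⟩ : ∃ i, k = j + 1 + i := ⟨k - (j + 1), by omega⟩
  have e1 : j + 1 + i - (j + 1) = i := by omega
  have e2 : j + 1 + i - j = i + 1 := by omega
  have hfac : localFactors F G lam xs ys (j + 1 + i) (j + 1) z =
      localFactors F G lam xs ys (j + 1 + i) j z + ((lam ^ (j + 1 + i)) ^ 2) •
        factorIncrement F G xs ys ((lam ^ j, (-lam) ^ (i + 1), lam ^ (j + 1 + i)), z,
          localFactors F G lam xs ys (j + 1 + i) j z) := by
    rw [← e2]; rfl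
  have hsq : ((-lam) ^ (i + 1)) ^ 2 = (lam ^ (i + 1)) ^ 2 := by
    rw [← pow_mul, ← pow_mul, mul_comm, pow_mul, pow_mul, neg_sq]
  have hpow : (lam ^ (j + 1 + i)) ^ 2 = (lam ^ j) ^ 2 * ((-lam) ^ (i + 1)) ^ 2 := by
    rw [hsq]; ring
  have hneg : -(1 / lam) * (-lam) ^ (i + 1) = (-lam) ^ i := by
    rw [pow_succ]; field_simp
  simp only [localOrbit, amplitudeX, amplitudeY, e1, e2]
  rw [hfac, hpow]
  set a := lam ^ j
  set b := (-lam) ^ (i + 1)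
  set e := lam ^ (j + 1 + i)
  set W := localFactors F G lam xs ys (j + 1 + i) j z
  have ha : lam ^ (j + 1) = lam * a := by rw [pow_succ, mul_comm]
  rw [ha, ← hneg]
  simp only [factorIncrement, Prod.fst_add, Prod.snd_add, Prod.smul_fst, Prod.smul_snd, smul_eq_mul]
  ext <;> ring

variable {F G lam xs ys} {l : Filter ℕ}

theorem tendsto_nat_mul_pow (hl : l ≤ atTop) (hlam : |lam| < 1) :
    Tendsto (fun k : ℕ => (k : ℝ) * lam ^ k) l (𝓝 0) :=
  (tendsto_self_mul_const_pow_of_abs_lt_one hlam).mono_left hl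

theorem tendsto_pow_zero (hl : l ≤ atTop) (hlam : |lam| < 1) :
    Tendsto (fun k : ℕ => lam ^ k) l (𝓝 0) :=
  (tendsto_pow_atTop_nhds_zero_of_abs_lt_one hlam).mono_left hl

theorem norm_localParameters_le_one (hlam : |lam| < 1) (k j : ℕ) :
    ‖((lam ^ j, (-lam) ^ (k - j), lam ^ k) : ℝ × ℝ × ℝ)‖ ≤ 1 := by
  simp only [Prod.norm_mk, norm_pow, norm_neg, Real.norm_eq_abs]
  exact max_le (pow_le_one₀ (abs_nonneg _) hlam.le)
    (max_le (pow_le_one₀ (abs_nonneg _) hlam.le) (pow_le_one₀ (abs_nonneg _) hlam.le))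

theorem eventually_amplitude_near (hF : ContDiff ℝ 1 F) (hG : ContDiff ℝ 1 G) (hl : l ≤ atTop)
    (hlam : |lam| < 1) (z₀ : ℝ × ℝ) {ρ : ℝ} (hρ : 0 < ρ) :
    ∀ᶠ p : ℕ × (ℝ × ℝ) in l ×ˢ 𝓝 z₀, ∀ j ≤ p.1,
      |amplitudeX F G lam xs ys p.1 j p.2 - xs| < ρ ∧
      |amplitudeY F G lam xs ys p.1 j p.2 - ys| < ρ := by
  have hc : Continuous fun t : (ℝ × ℝ) × (ℝ × ℝ) =>
      ((xs + t.1.1) * t.2.1, (ys + t.1.2) * t.2.2) := by fun_prop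
  obtain ⟨r, hr, h⟩ := Metric.continuous_iff.1 hc ((0, 0), (1, 1)) ρ hρ
  have hsmall : Tendsto (fun p : ℕ × (ℝ × ℝ) => lam ^ p.1 • p.2) (l ×ˢ 𝓝 z₀) (𝓝 0) := by
    have := ((tendsto_pow_zero hl hlam).comp tendsto_fst).smul
      (tendsto_snd (f := l) (g := 𝓝 z₀))
    simpa using this
  filter_upwards [eventually_slowIterate_near (contDiff_factorIncrement hF hG xs ys) (1, 1)
    (fun k j => norm_localParameters_le_one hlam k j) (tendsto_pow_zero hl hlam)
    (tendsto_nat_mul_pow hl hlam) z₀ hr, Metric.tendsto_nhds.1 hsmall r hr] with p h1 h2 j hj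
  have h3 := h (lam ^ p.1 • p.2, localFactors F G lam xs ys p.1 j p.2) (by
    rw [Prod.dist_eq]
    exact max_lt h2 (by rw [dist_eq_norm]; exact h1 j hj))
  rw [Prod.dist_eq, max_lt_iff] at h3
  simpa [amplitudeX, amplitudeY, Real.dist_eq] using h3

/-- In the first half of the passage the orbit shadows the points (λ^j x*, 0), in the second half
the points (0, (-λ)^(k-j) y*). The index j = k is excluded because (0, y*) need not lie in N. -/
theorem eventually_localOrbit_mem (hF : ContDiff ℝ 1 F) (hG : ContDiff ℝ 1 G) (hl : l ≤ atTop)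
    (hlam : |lam| < 1) (z₀ : ℝ × ℝ) {K U : Set (ℝ × ℝ)} (hK : IsCompact K) (hU : IsOpen U)
    (hKU : K ⊆ U) (hKx : ∀ j : ℕ, (lam ^ j * xs, (0 : ℝ)) ∈ K)
    (hKy : ∀ i : ℕ, ((0 : ℝ), (-lam) ^ (i + 1) * ys) ∈ K) :
    ∀ᶠ p : ℕ × (ℝ × ℝ) in l ×ˢ 𝓝 z₀, ∀ j < p.1, localOrbit F G lam xs ys p.1 j p.2 ∈ U := by
  obtain ⟨δ, hδ, hδU⟩ := hK.exists_thickening_subset_open hU hKU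
  have hhalf : Tendsto (fun k : ℕ => |lam| ^ (k / 2) * (|xs| + |ys| + δ)) l (𝓝 0) := by
    have := ((tendsto_pow_atTop_nhds_zero_of_lt_one (abs_nonneg lam) hlam).comp
      (Nat.tendsto_div_const_atTop two_ne_zero)).mul_const (|xs| + |ys| + δ)
    rw [zero_mul] at this
    exact this.mono_left hl
  filter_upwards [eventually_amplitude_near (xs := xs) (ys := ys) hF hG hl hlam z₀ hδ,
    tendsto_fst.eventually (hhalf.eventually (gt_mem_nhds hδ))] with p h1 h2 j hj
  obtain ⟨hX, hY⟩ := h1 j hj.le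
  apply hδU
  rw [Metric.mem_thickening_iff]
  set A := amplitudeX F G lam xs ys p.1 j p.2
  set B := amplitudeY F G lam xs ys p.1 j p.2
  have hA : |A| ≤ |xs| + |ys| + δ := by
    have := abs_sub_abs_le_abs_sub A xs
    linarith [abs_nonneg ys]
  have hB : |B| ≤ |xs| + |ys| + δ := by
    have := abs_sub_abs_le_abs_sub B ys
    linarith [abs_nonneg xs]
  have hsmall : ∀ (i : ℕ) (c : ℝ), p.1 / 2 ≤ i → |c| ≤ |xs| + |ys| + δ → |lam| ^ i * |c| < δ := by
    intro i c hi hc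
    refine lt_of_le_of_lt ?_ h2
    exact mul_le_mul (pow_le_pow_of_le_one (abs_nonneg _) hlam.le hi) hc (abs_nonneg _)
      (by positivity)
  have hone : ∀ (i : ℕ) (c : ℝ), |c| < δ → |lam| ^ i * |c| < δ := fun i c hc =>
    (mul_le_of_le_one_left (abs_nonneg _) (pow_le_one₀ (abs_nonneg _) hlam.le)).trans_lt hc
  by_cases hjk : p.1 / 2 ≤ j
  · obtain ⟨i, hi⟩ : ∃ i, p.1 - j = i + 1 := ⟨p.1 - j - 1, by omega⟩
    refine ⟨_, hKy i, ?_⟩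
    rw [localOrbit, Prod.dist_eq, Real.dist_eq, Real.dist_eq]
    refine max_lt ?_ ?_
    · simpa [abs_mul] using hsmall j A hjk hA
    · simpa only [hi, ← mul_sub, abs_mul, abs_pow, abs_neg] using hone (i + 1) (B - ys) hY
  · refine ⟨_, hKx j, ?_⟩
    rw [localOrbit, Prod.dist_eq, Real.dist_eq, Real.dist_eq]
    refine max_lt ?_ ?_
    · simpa only [← mul_sub, abs_mul, abs_pow] using hone j (A - xs) hX
    · simpa [abs_mul] using hsmall (p.1 - j) B (by omega) hB

theorem iterate_rescaling_eq_localOrbit (hlam : lam ≠ 0) {f : ℝ × ℝ → ℝ × ℝ} {k : ℕ} {z : ℝ × ℝ}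
    (hf : ∀ j < k, f (localOrbit F G lam xs ys k j z) =
      (lam * (localOrbit F G lam xs ys k j z).1 *
        (1 + (localOrbit F G lam xs ys k j z).1 ^ 2 * (localOrbit F G lam xs ys k j z).2 ^ 2 *
          F (localOrbit F G lam xs ys k j z)),
       -(1 / lam) * (localOrbit F G lam xs ys k j z).2 *
        (1 + (localOrbit F G lam xs ys k j z).1 ^ 2 * (localOrbit F G lam xs ys k j z).2 ^ 2 *
          G (localOrbit F G lam xs ys k j z)))) :
    ∀ j ≤ k, f^[j] (rescaling lam xs ys k z) = localOrbit F G lam xs ys k j z := by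
  intro j
  induction j with
  | zero => intro _; rw [localOrbit_zero]; rfl
  | succ j ih =>
    intro hj
    rw [Function.iterate_succ_apply', ih (by omega), hf j (by omega),
      localOrbit_succ F G lam xs ys hlam (by omega)]

theorem eventually_localOrbit_product_lt (hF : ContDiff ℝ 1 F) (hG : ContDiff ℝ 1 G)
    (hl : l ≤ atTop) (hlam : |lam| < 1) (z₀ : ℝ × ℝ) {η : ℝ} (hη : 0 < η) :
    ∀ᶠ p : ℕ × (ℝ × ℝ) in l ×ˢ 𝓝 z₀, ∀ j ≤ p.1,
      |(localOrbit F G lam xs ys p.1 j p.2).1 * (localOrbit F G lam xs ys p.1 j p.2).2| < η := by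
  have ht : Tendsto (fun k : ℕ => |lam| ^ k * ((|xs| + 1) * (|ys| + 1))) l (𝓝 0) := by
    have := (tendsto_pow_zero (lam := |lam|) hl (by rwa [abs_abs])).mul_const
      ((|xs| + 1) * (|ys| + 1))
    rwa [zero_mul] at this
  filter_upwards [eventually_amplitude_near (xs := xs) (ys := ys) hF hG hl hlam z₀ one_pos,
    tendsto_fst.eventually (ht.eventually (gt_mem_nhds hη))] with p h1 h2 j hj
  obtain ⟨hX, hY⟩ := h1 j hj
  refine lt_of_le_of_lt ?_ h2
  simp only [localOrbit]
  set A := amplitudeX F G lam xs ys p.1 j p.2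
  set B := amplitudeY F G lam xs ys p.1 j p.2
  have hA : |A| ≤ |xs| + 1 := by
    have := abs_sub_abs_le_abs_sub A xs; linarith
  have hB : |B| ≤ |ys| + 1 := by
    have := abs_sub_abs_le_abs_sub B ys; linarith
  have e : |lam ^ j * A * ((-lam) ^ (p.1 - j) * B)| = |lam| ^ p.1 * (|A| * |B|) := by
    simp only [abs_mul, abs_pow, abs_neg]
    rw [mul_mul_mul_comm, ← pow_add, Nat.add_sub_cancel' hj]
  rw [e]
  gcongr

/-- Equal second coordinates would force one amplitude to be (-λ)^j times the other, although both
are close to y* > 0. This excludes short periods. -/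
theorem eventually_localOrbit_ne (hF : ContDiff ℝ 1 F) (hG : ContDiff ℝ 1 G)
    (hl : l ≤ atTop) (hlam0 : lam ≠ 0) (hlam : |lam| < 1) (hys : 0 < ys) (z₀ : ℝ × ℝ) :
    ∀ᶠ p : ℕ × (ℝ × ℝ) in l ×ˢ 𝓝 z₀, ∀ j ≤ p.1, 0 < j →
      localOrbit F G lam xs ys p.1 j p.2 ≠ localOrbit F G lam xs ys p.1 0 p.2 := by
  have hρ : 0 < ys * (1 - |lam|) / 4 := by
    have : 0 < 1 - |lam| := by linarith
    positivity
  filter_upwards [eventually_amplitude_near (xs := xs) (ys := ys) hF hG hl hlam z₀ hρ]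
    with p h1 j hj hj0 heq
  have hY := (h1 j hj).2
  have hY0 := (h1 0 (Nat.zero_le _)).2
  have h2 := congrArg Prod.snd heq
  simp only [localOrbit, Nat.sub_zero] at h2
  set B := amplitudeY F G lam xs ys p.1 j p.2
  set B₀ := amplitudeY F G lam xs ys p.1 0 p.2
  have h3 : B = (-lam) ^ j * B₀ := by
    have : (-lam) ^ (p.1 - j) * B = (-lam) ^ (p.1 - j) * ((-lam) ^ j * B₀) := by
      rw [h2, ← mul_assoc, ← pow_add, Nat.sub_add_cancel hj]
    exact mul_left_cancel₀ (pow_ne_zero _ (neg_ne_zero.2 hlam0)) this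
  have h4 : |B| ≤ |lam| * |B₀| := by
    rw [h3, abs_mul, abs_pow, abs_neg]
    gcongr
    exact pow_le_of_le_one (abs_nonneg _) hlam.le hj0.ne'
  rw [abs_lt] at hY hY0
  have h5 : |B₀| ≤ ys + ys * (1 - |lam|) / 4 := abs_le.2 ⟨by nlinarith [abs_nonneg lam], by linarith⟩
  have h6 := le_abs_self B
  have h7 : |lam| * |B₀| ≤ |lam| * (ys + ys * (1 - |lam|) / 4) :=
    mul_le_mul_of_nonneg_left h5 (abs_nonneg _)
  nlinarith [abs_nonneg lam]

/-- The end point of the orbit of `T₀`, rescaled near `(0, ys)`, together with the first order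
correction to its first coordinate. -/
noncomputable def localEndpoint (F G : ℝ × ℝ → ℝ) (lam xs ys : ℝ) (k : ℕ) (z : ℝ × ℝ) : ℝ × (ℝ × ℝ) :=
  (z.1 + (xs + lam ^ k * z.1) * ((lam ^ k)⁻¹ * ((localFactors F G lam xs ys k k z).1 - 1)),
    amplitudeX F G lam xs ys k k z,
    z.2 + (ys + lam ^ k * z.2) * ((lam ^ k)⁻¹ * ((localFactors F G lam xs ys k k z).2 - 1)))

theorem C1Tendsto.localEndpoint (hF : ContDiff ℝ 1 F) (hG : ContDiff ℝ 1 G)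
    (hl : l ≤ atTop) (hlam0 : lam ≠ 0) (hlam : |lam| < 1) (z₀ : ℝ × ℝ) :
    C1Tendsto l (localEndpoint F G lam xs ys) z₀ (z₀.1, xs, z₀.2)
      ((ContinuousLinearMap.fst ℝ ℝ ℝ).prod
        ((0 : ℝ × ℝ →L[ℝ] ℝ).prod (ContinuousLinearMap.snd ℝ ℝ ℝ))) := by
  have h1 := C1Tendsto.slowIterate_rescaled (contDiff_factorIncrement hF hG xs ys) (1, 1)
    (fun k j => norm_localParameters_le_one hlam k j) (tendsto_pow_zero hl hlam)
    (tendsto_nat_mul_pow hl hlam) z₀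
  have hid : C1Tendsto l (fun _ z => z) z₀ z₀ (ContinuousLinearMap.id ℝ (ℝ × ℝ)) := by
    have := C1Tendsto.of_contDiff (H := fun t : ℝ × (ℝ × ℝ) => t.2) contDiff_snd
      (tendsto_const_nhds (x := (0 : ℝ)) (f := l)) z₀
    simpa using this
  have hH : ContDiff ℝ 1 (fun t : ℝ × ((ℝ × ℝ) × (ℝ × ℝ)) =>
      (t.2.1.1 + (xs + t.1 * t.2.1.1) * t.2.2.1, (xs + t.1 * t.2.1.1) * (1 + t.1 * t.2.2.1),
        t.2.1.2 + (ys + t.1 * t.2.1.2) * t.2.2.2)) := by fun_prop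
  have h2 := (C1Tendsto.of_contDiff hH (tendsto_pow_zero hl hlam) (z₀, 0)).comp (hid.prodMk h1)
  have hder : HasFDerivAt (fun t : (ℝ × ℝ) × (ℝ × ℝ) => (t.1.1 + xs * t.2.1, xs, t.1.2 + ys * t.2.2))
      ((((ContinuousLinearMap.fst ℝ ℝ ℝ).comp (ContinuousLinearMap.fst ℝ (ℝ × ℝ) (ℝ × ℝ))) +
        xs • ((ContinuousLinearMap.fst ℝ ℝ ℝ).comp (ContinuousLinearMap.snd ℝ (ℝ × ℝ) (ℝ × ℝ)))).prod
        ((0 : (ℝ × ℝ) × (ℝ × ℝ) →L[ℝ] ℝ).prod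
        (((ContinuousLinearMap.snd ℝ ℝ ℝ).comp (ContinuousLinearMap.fst ℝ (ℝ × ℝ) (ℝ × ℝ))) +
        ys • ((ContinuousLinearMap.snd ℝ ℝ ℝ).comp
          (ContinuousLinearMap.snd ℝ (ℝ × ℝ) (ℝ × ℝ)))))) (z₀, 0) := by
    refine (hasFDerivAt_fst.fst.add (hasFDerivAt_snd.fst.const_mul xs)).prodMk
      ((hasFDerivAt_const xs _).prodMk (hasFDerivAt_fst.snd.add (hasFDerivAt_snd.snd.const_mul ys)))
  simp only [zero_mul, add_zero, mul_one, hder.fderiv, Prod.snd_zero, Prod.fst_zero,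
    mul_zero] at h2
  convert h2 using 1
  · funext k z
    have he : lam ^ k ≠ 0 := pow_ne_zero k hlam0
    simp only [_root_.localEndpoint, amplitudeX, localFactors, Prod.smul_fst, Prod.smul_snd,
      Prod.fst_sub, Prod.snd_sub, smul_eq_mul, mul_inv_cancel_left₀ he, add_sub_cancel]
  · refine ContinuousLinearMap.ext fun v => ?_
    simp

theorem localOrbit_end (hlam0 : lam ≠ 0) (k : ℕ) (z : ℝ × ℝ) :
    localOrbit F G lam xs ys k k z = (0, ys) + lam ^ k • (localEndpoint F G lam xs ys k z).2 := by
  have he : lam ^ k ≠ 0 := pow_ne_zero k hlam0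
  ext
  · simp [localOrbit, localEndpoint]
  · simp [localOrbit, localEndpoint, amplitudeY]
    field_simp
    ring

/-- The linear term of the second coordinate of f^m is ultimately divided by λ^(2k), so the
amplitude is needed to order λ^k: its constant part x* will cancel and the correction survives. -/
theorem localEndpoint_snd_fst (hlam0 : lam ≠ 0) (k : ℕ) (z : ℝ × ℝ) :
    (localEndpoint F G lam xs ys k z).2.1 = xs + lam ^ k * (localEndpoint F G lam xs ys k z).1 := by
  have he : lam ^ k ≠ 0 := pow_ne_zero k hlam0
  simp only [localEndpoint, amplitudeX]
  field_simp
  ring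

end LocalOrbit

/-! ### The renormalised return map and its fixed points -/

section Renormalization

/-- The inverse of the change of coordinates `rescaling`. -/
noncomputable def unscaling (lam xs ys : ℝ) (k : ℕ) (y : ℝ × ℝ) : ℝ × ℝ :=
  ((lam ^ k)⁻¹ * (y.1 - xs), (lam ^ k)⁻¹ * (((-lam) ^ k)⁻¹ * y.2 - ys))

variable {F G : ℝ × ℝ → ℝ} {lam xs ys : ℝ} {l : Filter ℕ}

theorem rescaling_unscaling (hlam0 : lam ≠ 0) (k : ℕ) (y : ℝ × ℝ) :
    rescaling lam xs ys k (unscaling lam xs ys k y) = y := by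
  have h1 : lam ^ k ≠ 0 := pow_ne_zero k hlam0
  have h2 : (-lam) ^ k ≠ 0 := pow_ne_zero k (neg_ne_zero.2 hlam0)
  ext
  · simp [unscaling, rescaling, h1]
  · simp [unscaling, rescaling, h1, h2]

theorem hasFDerivAt_rescaling (k : ℕ) (z : ℝ × ℝ) :
    HasFDerivAt (rescaling lam xs ys k)
      ((lam ^ k • ContinuousLinearMap.fst ℝ ℝ ℝ).prod
        ((-lam) ^ k • lam ^ k • ContinuousLinearMap.snd ℝ ℝ ℝ)) z :=
  ((hasFDerivAt_fst.const_mul (lam ^ k)).const_add xs).prodMk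
    (((hasFDerivAt_snd.const_mul (lam ^ k)).const_add ys).const_mul ((-lam) ^ k))

theorem tendsto_rescaling (hl : l ≤ atTop) (hlam : |lam| < 1) (z₀ : ℝ × ℝ) :
    Tendsto (fun p : ℕ × (ℝ × ℝ) => rescaling lam xs ys p.1 p.2) (l ×ˢ 𝓝 z₀) (𝓝 (xs, 0)) := by
  have h1 := (tendsto_pow_zero hl hlam).comp (tendsto_fst (f := l) (g := 𝓝 z₀))
  have h2 := (tendsto_pow_zero (lam := -lam) hl (by rwa [abs_neg])).comp
    (tendsto_fst (f := l) (g := 𝓝 z₀))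
  have h3 := tendsto_snd (f := l) (g := 𝓝 z₀)
  have := ((h1.mul h3.fst_nhds).const_add xs).prodMk_nhds
    (h2.mul ((h1.mul h3.snd_nhds).const_add ys))
  simp only [zero_mul, add_zero] at this
  exact this

/-- Rescaled, the return map converges to a generalised Hénon map. -/
theorem C1Tendsto.renormalization (hF : ContDiff ℝ 1 F) (hG : ContDiff ℝ 1 G)
    (hl : l ≤ atTop) (hlam0 : lam ≠ 0) (hlam : |lam| < 1) {T₁ T₂ : ℝ × ℝ → ℝ}
    (hT₁ : ContDiff ℝ 2 T₁) (hT₂ : ContDiff ℝ 2 T₂) (h₁ : T₁ (0, ys) = xs) (h₂ : T₂ (0, ys) = 0)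
    {d s : ℝ} (hd : ∀ v : ℝ × ℝ, fderiv ℝ T₂ (0, ys) v = d * v.1) (hs : s * d * xs = ys)
    (hs2 : s * s = 1) (hsl : ∀ᶠ k : ℕ in l, (-1) ^ k = s) (z₀ : ℝ × ℝ) :
    ∃ L : ℝ × ℝ →L[ℝ] ℝ × ℝ,
      C1Tendsto l (fun k z => unscaling lam xs ys k
          (T₁ (localOrbit F G lam xs ys k k z), T₂ (localOrbit F G lam xs ys k k z))) z₀
        (fderiv ℝ T₁ (0, ys) (xs, z₀.2),
          s * (fderiv ℝ (fderiv ℝ T₂) (0, ys) (xs, z₀.2) (xs, z₀.2) / 2 + d * z₀.1)) L ∧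
      ∀ v, L v = (fderiv ℝ T₁ (0, ys) (0, v.2),
        s * (fderiv ℝ (fderiv ℝ T₂) (0, ys) (xs, z₀.2) (0, v.2) + d * v.1)) := by
  have he := tendsto_pow_zero hl hlam
  have he0 : ∀ᶠ k in l, lam ^ k ≠ 0 := .of_forall fun k => pow_ne_zero k hlam0
  have hE := C1Tendsto.localEndpoint (xs := xs) (ys := ys) hF hG hl hlam0 hlam z₀
  have hfst : C1Tendsto l (fun _ (t : ℝ × (ℝ × ℝ)) => t.1) (z₀.1, xs, z₀.2) z₀.1
      (ContinuousLinearMap.fst ℝ ℝ (ℝ × ℝ)) := by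
    have := C1Tendsto.of_contDiff (H := fun t : ℝ × (ℝ × (ℝ × ℝ)) => t.2.1)
      (contDiff_fst.comp contDiff_snd) (tendsto_const_nhds (x := (0 : ℝ)) (f := l)) (z₀.1, xs, z₀.2)
    simpa [fderiv_fst] using this
  have hsnd : C1Tendsto l (fun _ (t : ℝ × (ℝ × ℝ)) => t.2) (z₀.1, xs, z₀.2) (xs, z₀.2)
      (ContinuousLinearMap.snd ℝ ℝ (ℝ × ℝ)) := by
    have := C1Tendsto.of_contDiff (H := fun t : ℝ × (ℝ × (ℝ × ℝ)) => t.2.2)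
      (contDiff_snd.comp contDiff_snd) (tendsto_const_nhds (x := (0 : ℝ)) (f := l)) (z₀.1, xs, z₀.2)
    simpa [fderiv_snd] using this
  have hψ₁ := (C1Tendsto.rescaled_first_order (hT₁.of_le (by norm_num)) (0, ys) he he0
    (xs, z₀.2)).comp hsnd
  have hψ₂ := (C1Tendsto.rescaled_second_order hT₂ (0, ys) he he0 (xs, z₀.2)).comp hsnd
  have hlin : ContDiff ℝ 1 (fun t : ℝ × (ℝ × (ℝ × ℝ)) => (t.2.1, s * (t.2.2.1 + d * t.2.2.2))) := by
    fun_prop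
  have hlinder : ∀ y, HasFDerivAt (fun t : ℝ × (ℝ × ℝ) => (t.1, s * (t.2.1 + d * t.2.2)))
      ((ContinuousLinearMap.fst ℝ ℝ (ℝ × ℝ)).prod
        (s • ((ContinuousLinearMap.fst ℝ ℝ ℝ).comp (ContinuousLinearMap.snd ℝ ℝ (ℝ × ℝ)) +
        d • (ContinuousLinearMap.snd ℝ ℝ ℝ).comp (ContinuousLinearMap.snd ℝ ℝ (ℝ × ℝ))))) y :=
    fun y => hasFDerivAt_fst.prodMk
      ((hasFDerivAt_snd.fst.add (hasFDerivAt_snd.snd.const_mul d)).const_mul s)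
  have hcomb := C1Tendsto.of_contDiff hlin (tendsto_const_nhds (x := (0 : ℝ)) (f := l))
    (fderiv ℝ T₁ (0, ys) (xs, z₀.2),
      fderiv ℝ (fderiv ℝ T₂) (0, ys) (xs, z₀.2) (xs, z₀.2) / 2, z₀.1)
  rw [(hlinder _).fderiv] at hcomb
  have hall := (hcomb.comp (hψ₁.prodMk (hψ₂.prodMk hfst))).comp hE
  refine ⟨_, hall.congr ?_, fun v => by simp [mul_add]⟩
  -- With (-λ)^k = s λ^k, the relation s d x* = y* cancels the term of order λ^(-k).
  filter_upwards [tendsto_fst.eventually hsl] with p hp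
  have h1 : lam ^ p.1 ≠ 0 := pow_ne_zero _ hlam0
  have hneg : (-lam) ^ p.1 = s * lam ^ p.1 := by rw [neg_pow, hp]
  have hs0 : s ≠ 0 := fun h => by simp [h] at hs2
  rw [localOrbit_end hlam0, unscaling, hneg, h₁, h₂, hd]
  rw [localEndpoint_snd_fst hlam0]
  ext
  · rfl
  · simp only
    field_simp
    linear_combination
      (T₂ ((0, ys) + lam ^ p.1 • (_root_.localEndpoint F G lam xs ys p.1 p.2).2)) * hs2 -
        s * lam ^ p.1 * hs

/-- The determinant of L - 1 is 1 - trace + determinant of L. -/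
theorem exists_continuousLinearEquiv_sub_id (L : ℝ × ℝ →L[ℝ] ℝ × ℝ)
    (h : planeTrace L ≠ 1 + planeDet L) :
    ∃ A : (ℝ × ℝ) ≃L[ℝ] ℝ × ℝ,
      (A : ℝ × ℝ →L[ℝ] ℝ × ℝ) = L - ContinuousLinearMap.id ℝ (ℝ × ℝ) := by
  have hinj : Function.Injective
      ((L - ContinuousLinearMap.id ℝ (ℝ × ℝ) : ℝ × ℝ →L[ℝ] ℝ × ℝ) : ℝ × ℝ →ₗ[ℝ] ℝ × ℝ) := by
    rw [injective_iff_map_eq_zero]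
    intro v hv
    have hv' : L v - v = 0 := hv
    rw [plane_apply L v] at hv'
    have e1 := congrArg Prod.fst hv'
    have e2 := congrArg Prod.snd hv'
    simp only [Prod.fst_sub, Prod.snd_sub, Prod.fst_zero, Prod.snd_zero] at e1 e2
    have hne : 1 + planeDet L - planeTrace L ≠ 0 := fun h0 => h (by linarith)
    unfold planeDet planeTrace at hne
    ext
    · refine (mul_eq_zero.1 ?_).resolve_left hne
      linear_combination ((L (0, 1)).2 - 1) * e1 - (L (0, 1)).1 * e2
    · refine (mul_eq_zero.1 ?_).resolve_left hne
      linear_combination ((L (1, 0)).1 - 1) * e2 - (L (1, 0)).2 * e1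
  refine ⟨(LinearEquiv.ofInjectiveEndo _ hinj).toContinuousLinearEquiv, ?_⟩
  ext <;> rfl

theorem contDiff_iterate {E : Type*} [NormedAddCommGroup E] [NormedSpace ℝ E] {n : WithTop ℕ∞}
    {f : E → E} (hf : ContDiff ℝ n f) (j : ℕ) : ContDiff ℝ n f^[j] := by
  induction j with
  | zero => exact contDiff_id
  | succ j ih => exact ih.comp hf

/-- The least period divides k + m and exceeds k ≥ m, so its double already exceeds k + m. -/
theorem minimalPeriod_eq_of_forall_ne {α : Type*} {f : α → α} {x : α} {k m : ℕ} (hm : 1 ≤ m)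
    (hmk : m ≤ k) (hx : f^[k + m] x = x) (hne : ∀ j ≤ k, 0 < j → f^[j] x ≠ x) :
    Function.minimalPeriod f x = k + m := by
  have hper : Function.IsPeriodicPt f (k + m) x := hx
  have hdvd := hper.minimalPeriod_dvd
  have hpos := hper.minimalPeriod_pos (by omega)
  have hgt : k < Function.minimalPeriod f x := by
    by_contra! hle
    exact hne _ hle hpos (Function.iterate_minimalPeriod)
  obtain ⟨c, hc⟩ := hdvd
  have : c = 1 := by
    have h2 : c < 2 := by
      by_contra! h2
      nlinarith
    interval_cases c <;> omega
  rw [this] at hc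
  omega

/-- Since a may be negative, even powers use the segment from 0 to x and odd powers the segment from
0 to a x. Hence two points on each axis are required in N. -/
theorem pow_smul_mem_of_convex {V : Type*} [AddCommGroup V] [Module ℝ V] {C : Set V}
    (hC : Convex ℝ C) (h0 : (0 : V) ∈ C) {x : V} {a : ℝ} (ha : |a| ≤ 1) (hx : x ∈ C)
    (hax : a • x ∈ C) (j : ℕ) : a ^ j • x ∈ C := by
  obtain ⟨i, rfl | rfl⟩ := Nat.even_or_odd' j
  · refine hC.smul_mem_of_zero_mem h0 hx ⟨?_, ?_⟩
    · rw [pow_mul]; positivity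
    · rw [pow_mul]; exact pow_le_one₀ (sq_nonneg a) (by rwa [sq_le_one_iff_abs_le_one])
  · rw [pow_succ, mul_smul]
    refine hC.smul_mem_of_zero_mem h0 hax ⟨?_, ?_⟩
    · rw [pow_mul]; positivity
    · rw [pow_mul]; exact pow_le_one₀ (sq_nonneg a) (by rwa [sq_le_one_iff_abs_le_one])

/-- A nondegenerate fixed point of the limiting Hénon map gives a family of `SR_k`-solutions. -/
theorem exists_SRSolution_family {f : ℝ × ℝ → ℝ × ℝ} (hf : ContDiff ℝ ∞ f)
    (hlam0 : lam ≠ 0) (hlam : |lam| < 1) {N : Set (ℝ × ℝ)} (hN : IsOpen N) (hNc : Convex ℝ N)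
    (hN0 : ((0, 0) : ℝ × ℝ) ∈ N) (hF : ContDiffOn ℝ ∞ F N) (hG : ContDiffOn ℝ ∞ G N)
    (hT₀ : ∀ x y : ℝ, (x, y) ∈ N →
      f (x, y) = (lam * x * (1 + x ^ 2 * y ^ 2 * F (x, y)),
        -(1 / lam) * y * (1 + x ^ 2 * y ^ 2 * G (x, y))))
    (hys : 0 < ys) (h₁ : (xs, (0 : ℝ)) ∈ N) (h₂ : (lam * xs, (0 : ℝ)) ∈ N)
    (h₃ : ((0 : ℝ), -lam * ys) ∈ N) (h₄ : ((0 : ℝ), (-lam) ^ 2 * ys) ∈ N)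
    {m : ℕ} (hm : 1 ≤ m) (hhom : f^[m] (0, ys) = (xs, 0)) {d s : ℝ}
    (hd : ∀ v : ℝ × ℝ, fderiv ℝ (fun p => (f^[m] p).2) (0, ys) v = d * v.1)
    (hs : s * d * xs = ys) (hs2 : s * s = 1) (hl : l ≤ atTop)
    (hsl : ∀ᶠ k : ℕ in l, (-1) ^ k = s) {u v τ D : ℝ}
    (hu : fderiv ℝ (fun p => (f^[m] p).1) (0, ys) (xs, v) = u)
    (hv : s * (fderiv ℝ (fderiv ℝ (fun p => (f^[m] p).2)) (0, ys) (xs, v) (xs, v) / 2 + d * u) = v)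
    (hτ : s * fderiv ℝ (fderiv ℝ (fun p => (f^[m] p).2)) (0, ys) (xs, v) (0, 1) = τ)
    (hD : -(fderiv ℝ (fun p => (f^[m] p).1) (0, ys) (0, 1) * (s * d)) = D) (hne : τ ≠ 1 + D) :
    ∃ p : ℕ → ℝ × ℝ, Tendsto p l (𝓝 (xs, 0)) ∧
      (∀ η > 0, ∀ᶠ k in l, IsSRSolution f N η m k (p k)) ∧
      Tendsto (fun k => planeTrace (fderiv ℝ f^[k + m] (p k))) l (𝓝 τ) ∧
      Tendsto (fun k => planeDet (fderiv ℝ f^[k + m] (p k))) l (𝓝 D) := by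
  have hNx : ∀ j : ℕ, (lam ^ j * xs, (0 : ℝ)) ∈ N := fun j => by
    have := pow_smul_mem_of_convex hNc hN0 hlam.le h₁ (by simpa using h₂) j
    simpa using this
  have hNy : ∀ i : ℕ, ((0 : ℝ), (-lam) ^ (i + 1) * ys) ∈ N := fun i => by
    have := pow_smul_mem_of_convex (a := -lam) hNc hN0 (by rw [abs_neg]; exact hlam.le) h₃
      (by simpa [pow_two, mul_assoc] using h₄) i
    simpa [pow_succ, mul_assoc] using this
  obtain ⟨K, hK, hKN, hKx, hKy⟩ : ∃ K : Set (ℝ × ℝ), IsCompact K ∧ K ⊆ N ∧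
      (∀ j : ℕ, (lam ^ j * xs, (0 : ℝ)) ∈ K) ∧
      (∀ i : ℕ, ((0 : ℝ), (-lam) ^ (i + 1) * ys) ∈ K) := by
    -- The hull of finitely many points of N is compact, lies in N and contains both axis sequences.
    set S : Set (ℝ × ℝ) := {(0, 0), (xs, 0), (lam * xs, 0), (0, -lam * ys), (0, (-lam) ^ 2 * ys)}
    have hS : ∀ x ∈ S, x ∈ convexHull ℝ S := fun x hx => subset_convexHull ℝ S hx
    have hfin : S.Finite := Set.toFinite _
    refine ⟨convexHull ℝ S, hfin.isCompact_convexHull ℝ, convexHull_min ?_ hNc, ?_, ?_⟩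
    · rintro x (rfl | rfl | rfl | rfl | rfl) <;> assumption
    · intro j
      have := pow_smul_mem_of_convex (convex_convexHull ℝ S) (hS (0, 0) (by simp [S])) hlam.le
        (hS (xs, 0) (by simp [S])) (hS _ (by simp [S])) j
      simpa using this
    · intro i
      have := pow_smul_mem_of_convex (a := -lam) (convex_convexHull ℝ S) (hS (0, 0) (by simp [S]))
        (by rw [abs_neg]; exact hlam.le)
        (hS (0, -lam * ys) (by simp [S])) (hS _ (by simp [S, pow_two, mul_assoc])) i
      simpa [pow_succ, mul_assoc] using this
  obtain ⟨F', hF', U₁, hU₁, hKU₁, hFU⟩ := exists_contDiff_extension hN hK hKN hF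
  obtain ⟨G', hG', U₂, hU₂, hKU₂, hGU⟩ := exists_contDiff_extension hN hK hKN hG
  have hF1 : ContDiff ℝ 1 F' := hF'.of_le (by exact_mod_cast le_top)
  have hG1 : ContDiff ℝ 1 G' := hG'.of_le (by exact_mod_cast le_top)
  set z₀ : ℝ × ℝ := (u, v) with hz₀
  have hmem := eventually_localOrbit_mem (xs := xs) (ys := ys) hF1 hG1 hl hlam z₀ hK
    ((hU₁.inter hU₂).inter hN) (fun x hx => ⟨⟨hKU₁ hx, hKU₂ hx⟩, hKN hx⟩) hKx hKy
  have horbit : ∀ᶠ p : ℕ × (ℝ × ℝ) in l ×ˢ 𝓝 z₀, ∀ j ≤ p.1,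
      f^[j] (rescaling lam xs ys p.1 p.2) = localOrbit F' G' lam xs ys p.1 j p.2 := by
    filter_upwards [hmem] with p hp
    refine iterate_rescaling_eq_localOrbit hlam0 fun j hj => ?_
    obtain ⟨⟨hj1, hj2⟩, hj3⟩ := hp j hj
    rw [hFU hj1, hGU hj2]
    exact hT₀ _ _ hj3
  have hfm : ContDiff ℝ ∞ f^[m] := contDiff_iterate hf m
  have hle : (2 : WithTop ℕ∞) ≤ ∞ := WithTop.coe_le_coe.2 (le_top : (2 : ℕ∞) ≤ ⊤)
  obtain ⟨L, hL, hLv⟩ := C1Tendsto.renormalization hF1 hG1 hl hlam0 hlam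
    (T₁ := fun p => (f^[m] p).1) (T₂ := fun p => (f^[m] p).2)
    (contDiff_fst.comp (hfm.of_le hle)) (contDiff_snd.comp (hfm.of_le hle))
    (by simp [hhom]) (by simp [hhom]) hd hs hs2 hsl z₀
  simp only [hz₀, hu, hv] at hL hLv
  have hLtr : planeTrace L = τ := by
    rw [planeTrace, hLv, hLv, ← hτ]; simp [Prod.mk_zero_zero]
  have hLdet : planeDet L = D := by
    rw [planeDet, hLv, hLv, ← hD]; simp [Prod.mk_zero_zero]
  have hΦ : C1Tendsto l (fun k z => unscaling lam xs ys k
      (f^[k + m] (rescaling lam xs ys k z))) z₀ z₀ L := by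
    refine hL.congr ?_
    filter_upwards [horbit] with p hp
    rw [Nat.add_comm, Function.iterate_add_apply, hp p.1 le_rfl]
  obtain ⟨A, hA⟩ := exists_continuousLinearEquiv_sub_id L (by rwa [hLtr, hLdet])
  obtain ⟨x, hx, hfix⟩ := hΦ.exists_fixedPoints A hA
  have hkx : Tendsto (fun k => (k, x k)) l (l ×ˢ 𝓝 z₀) := tendsto_id.prodMk hx
  have hfd : Tendsto (fun k => fderiv ℝ (fun z => unscaling lam xs ys k
      (f^[k + m] (rescaling lam xs ys k z))) (x k)) l (𝓝 L) := hΦ.tendsto_fderiv.comp hkx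
  have hconj : ∀ᶠ k in l,
      planeTrace (fderiv ℝ f^[k + m] (rescaling lam xs ys k (x k))) =
        planeTrace (fderiv ℝ (fun z => unscaling lam xs ys k
          (f^[k + m] (rescaling lam xs ys k z))) (x k)) ∧
      planeDet (fderiv ℝ f^[k + m] (rescaling lam xs ys k (x k))) =
        planeDet (fderiv ℝ (fun z => unscaling lam xs ys k
          (f^[k + m] (rescaling lam xs ys k z))) (x k)) := by
    filter_upwards [hkx.eventually hΦ.differentiableAt] with k hk
    -- The rescaling semiconjugates the renormalised map to f^(k+m), and its derivative is diagonal.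
    refine planeTrace_planeDet_of_diagonal_conj _ _ (lam ^ k) ((-lam) ^ k * lam ^ k)
      (pow_ne_zero _ hlam0) (mul_ne_zero (pow_ne_zero _ (neg_ne_zero.2 hlam0))
        (pow_ne_zero _ hlam0)) fun w => ?_
    have hfk : HasFDerivAt f^[k + m] _ (rescaling lam xs ys k (x k)) :=
      (((hf.differentiable (by simp)).iterate (k + m)) _).hasFDerivAt
    have e1 := hfk.comp (x k) (hasFDerivAt_rescaling k (x k))
    have e2 := (hasFDerivAt_rescaling (lam := lam) (xs := xs) (ys := ys) k _).comp (x k)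
      hk.hasFDerivAt
    have e3 : (rescaling lam xs ys k ∘ fun z => unscaling lam xs ys k
        (f^[k + m] (rescaling lam xs ys k z))) = f^[k + m] ∘ rescaling lam xs ys k := by
      funext z
      exact rescaling_unscaling hlam0 k _
    rw [e3] at e2
    have e4 := congrArg (fun M : ℝ × ℝ →L[ℝ] ℝ × ℝ => M w) (e1.unique e2)
    simpa [mul_assoc] using e4
  refine ⟨fun k => rescaling lam xs ys k (x k), (tendsto_rescaling hl hlam z₀).comp hkx, ?_, ?_, ?_⟩
  · intro η hη
    have hprod := eventually_localOrbit_product_lt (xs := xs) (ys := ys) hF1 hG1 hl hlam z₀ hη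
    have hnr := eventually_localOrbit_ne (xs := xs) hF1 hG1 hl hlam0 hlam hys z₀
    filter_upwards [hkx.eventually hprod, hkx.eventually hnr, hkx.eventually hmem,
      hkx.eventually horbit, hfix, hl (eventually_ge_atTop m)] with k a1 a2 a3 a4 a5 a6
    have hper : f^[k + m] (rescaling lam xs ys k (x k)) = rescaling lam xs ys k (x k) := by
      have := congrArg (rescaling lam xs ys k) a5
      rwa [rescaling_unscaling hlam0] at this
    refine ⟨by omega, minimalPeriod_eq_of_forall_ne hm a6 hper fun j hj hj0 => ?_, fun j hj => ?_⟩
    · rw [a4 j hj]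
      have := a2 j hj hj0
      rwa [localOrbit_zero] at this
    · rw [a4 j hj.le]
      exact ⟨(a3 j hj).2, a1 j hj.le⟩
  · refine (((continuous_planeTrace.tendsto L).comp hfd).congr' ?_).trans (by rw [hLtr])
    filter_upwards [hconj] with k hk using hk.1.symm
  · refine (((continuous_planeDet.tendsto L).comp hfd).congr' ?_).trans (by rw [hLdet])
    filter_upwards [hconj] with k hk using hk.2.symm

end Renormalization

/-! ### Partial derivatives and the main theorem -/

theorem fderiv_apply_eq_partial {g : ℝ × ℝ → ℝ} (p v : ℝ × ℝ) :
    fderiv ℝ g p v = v.1 * partialX g p + v.2 * partialY g p := by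
  have : v = v.1 • ((1, 0) : ℝ × ℝ) + v.2 • ((0, 1) : ℝ × ℝ) := by ext <;> simp
  conv_lhs => rw [this, map_add, map_smul, map_smul]
  rfl

theorem fderiv_fderiv_apply_eq_partial {g : ℝ × ℝ → ℝ} (hg : ContDiff ℝ 2 g) (p v w : ℝ × ℝ) :
    fderiv ℝ (fderiv ℝ g) p v w =
      v.1 * w.1 * partialX (partialX g) p + (v.1 * w.2 + v.2 * w.1) * partialX (partialY g) p +
        v.2 * w.2 * partialY (partialY g) p := by
  have hd : DifferentiableAt ℝ (fderiv ℝ g) p :=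
    (hg.fderiv_right (m := 1) (by norm_num)).differentiable (by norm_num) p
  have happ : ∀ a b : ℝ × ℝ, fderiv ℝ (fun q => fderiv ℝ g q b) p a =
      fderiv ℝ (fderiv ℝ g) p a b := fun a b => by
    rw [fderiv_clm_apply hd (differentiableAt_const b)]
    simp
  have hsymm : fderiv ℝ (fderiv ℝ g) p (0, 1) (1, 0) = fderiv ℝ (fderiv ℝ g) p (1, 0) (0, 1) :=
    hg.contDiffAt.isSymmSndFDerivAt (x := p) (by simp) _ _
  have hxx : partialX (partialX g) p = fderiv ℝ (fderiv ℝ g) p (1, 0) (1, 0) := happ _ _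
  have hxy : partialX (partialY g) p = fderiv ℝ (fderiv ℝ g) p (1, 0) (0, 1) := happ _ _
  have hyy : partialY (partialY g) p = fderiv ℝ (fderiv ℝ g) p (0, 1) (0, 1) := happ _ _
  have e : ∀ v : ℝ × ℝ, v = v.1 • ((1, 0) : ℝ × ℝ) + v.2 • ((0, 1) : ℝ × ℝ) := fun v => by
    ext <;> simp
  conv_lhs => rw [e v, e w]
  simp only [map_add, map_smul, add_apply, smul_apply, smul_eq_mul, hsymm, hxx, hxy, hyy]
  ring

theorem mainTheorem4
    (f : ℝ × ℝ → ℝ × ℝ) (hf : ContDiff ℝ ∞ f)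
    (lam σ : ℝ) (hlam0 : 0 < |lam|) (hlam1 : |lam| < 1) (hlamσ : lam * σ = -1)
    -- the local form `T₀` of `f` on the neighbourhood `N` of the origin
    (N : Set (ℝ × ℝ)) (hNopen : IsOpen N) (hNconvex : Convex ℝ N)
    (hNbounded : Bornology.IsBounded N) (hN0 : ((0, 0) : ℝ × ℝ) ∈ N)
    (F G : ℝ × ℝ → ℝ) (hF : ContDiffOn ℝ ∞ F N) (hG : ContDiffOn ℝ ∞ G N)
    (hT₀ : ∀ x y : ℝ, (x, y) ∈ N →
      f (x, y) = (lam * x * (1 + x ^ 2 * y ^ 2 * F (x, y)),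
        -(1 / lam) * y * (1 + x ^ 2 * y ^ 2 * G (x, y))))
    -- the points `(xs, 0)` and `(0, ys)` of the homoclinic orbit
    (xs ys : ℝ) (hxs : 0 < xs) (hys : 0 < ys)
    (h₁ : (xs, (0 : ℝ)) ∈ N) (h₂ : (lam * xs, (0 : ℝ)) ∈ N)
    (h₃ : ((0 : ℝ), ys / σ) ∈ N) (h₄ : ((0 : ℝ), ys / σ ^ 2) ∈ N)
    (m : ℕ) (hm : 1 ≤ m) (hhom : f^[m] (0, ys) = (xs, 0))
    -- the Taylor coefficients of `T₁ = f^m` at `(0, ys)`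
    (c₁ c₂ d₁ d₂ d₃ d₄ d₅ : ℝ)
    (hc₁ : c₁ = partialX (fun p => (f^[m] p).1) (0, ys))
    (hc₂ : c₂ = partialY (fun p => (f^[m] p).1) (0, ys))
    (hd₁ : d₁ = partialX (fun p => (f^[m] p).2) (0, ys))
    (hd₂ : d₂ = partialY (fun p => (f^[m] p).2) (0, ys))
    (hd₃ : d₃ = partialX (partialX (fun p => (f^[m] p).2)) (0, ys) / 2)
    (hd₄ : d₄ = partialX (partialY (fun p => (f^[m] p).2)) (0, ys))
    (hd₅ : d₅ = partialY (partialY (fun p => (f^[m] p).2)) (0, ys) / 2)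
    -- the conditions on the coefficients
    (hd₁abs : |d₁| = ys / xs) (hd₂zero : d₂ = 0) (hd₅ne : d₅ ≠ 0)
    (Δ : ℝ)
    (hΔ : Δ = (1 - c₂ * ys / xs - d₄ * ys / d₁) ^ 2 - 4 * d₅ * (d₃ * xs ^ 2 + c₁ * d₁ * xs))
    (hΔpos : 0 < Δ)
    (hstab₁ : -1 < c₂ * ys / xs) (hstab₂ : c₂ * ys / xs < 1 - √Δ / 2) :
    ∃ p q : ℕ → ℝ × ℝ,
      Tendsto p atTop (𝓝 (xs, 0)) ∧ Tendsto q atTop (𝓝 (xs, 0)) ∧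
      ∀ η > 0, ∃ kmin : ℕ, ∀ k ≥ kmin,
        ((d₁ = ys / xs ∧ Even k) ∨ (d₁ = -(ys / xs) ∧ Odd k)) →
          (IsSRSolution f N η m k (p k) ∧ IsAsymptoticallyStable f (p k)) ∧
          (IsSRSolution f N η m k (q k) ∧ IsSaddle f (k + m) (q k)) := by
  have hlamne : lam ≠ 0 := abs_pos.1 hlam0
  have hσ : σ = -lam⁻¹ := by field_simp; linarith
  have hd₁pos : 0 < |d₁| := by rw [hd₁abs]; positivity
  have hd₁ne : d₁ ≠ 0 := abs_pos.1 hd₁pos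
  have h₃' : ((0 : ℝ), -lam * ys) ∈ N := by
    convert h₃ using 2; rw [hσ]; field_simp
  have h₄' : ((0 : ℝ), (-lam) ^ 2 * ys) ∈ N := by
    convert h₄ using 2; rw [hσ]; field_simp
  -- s is the sign of d₁, and equals (-1)^k for the admissible parity of k.
  obtain ⟨s, hs2, hsd, hsk⟩ : ∃ s : ℝ, s * s = 1 ∧ s * d₁ * xs = ys ∧
      ∀ k : ℕ, ((d₁ = ys / xs ∧ Even k) ∨ (d₁ = -(ys / xs) ∧ Odd k)) → (-1) ^ k = s := by
    have hpos : 0 < ys / xs := by positivity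
    rcases lt_or_gt_of_ne hd₁ne with h | h
    · rw [abs_of_neg h] at hd₁abs
      refine ⟨-1, by norm_num, ?_, ?_⟩
      · rw [neg_one_mul, hd₁abs]; field_simp
      · rintro k (⟨h1, -⟩ | ⟨-, h2⟩)
        · linarith
        · exact h2.neg_one_pow
    · rw [abs_of_pos h] at hd₁abs
      refine ⟨1, by norm_num, ?_, ?_⟩
      · rw [one_mul, hd₁abs]; field_simp
      · rintro k (⟨-, h2⟩ | ⟨h1, -⟩)
        · exact h2.neg_one_pow
        · linarith
  have hfm : ContDiff ℝ ∞ f^[m] := contDiff_iterate hf m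
  have hT₂ : ContDiff ℝ 2 (fun p => (f^[m] p).2) :=
    contDiff_snd.comp (hfm.of_le (WithTop.coe_le_coe.2 (le_top : (2 : ℕ∞) ≤ ⊤)))
  set D := -(c₂ * (s * d₁)) with hD
  have hcD : c₂ * ys / xs = -D := by
    rw [hD, ← hsd]; field_simp
  have hdD : d₄ * ys / d₁ = s * d₄ * xs := by
    rw [← hsd]; field_simp
  set l : Filter ℕ := atTop ⊓ 𝓟 {k | (-1 : ℝ) ^ k = s} with hl
  have hsl : ∀ᶠ k : ℕ in l, (-1) ^ k = s := mem_inf_of_right (mem_principal_self _)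
  have family : ∀ w : ℝ, w ^ 2 = Δ → ∃ p : ℕ → ℝ × ℝ, Tendsto p l (𝓝 (xs, 0)) ∧
      (∀ η > 0, ∀ᶠ k in l, IsSRSolution f N η m k (p k)) ∧
      Tendsto (fun k => planeTrace (fderiv ℝ f^[k + m] (p k))) l (𝓝 (1 + D + w)) ∧
      Tendsto (fun k => planeDet (fderiv ℝ f^[k + m] (p k))) l (𝓝 D) := by
    intro w hw
    have hw0 : w ≠ 0 := fun h => by rw [h] at hw; norm_num at hw; linarith
    -- The quadratic formula for the second coordinate of a fixed point, with w = ±√Δ; it makes the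
    -- trace 1 + D + w.
    obtain ⟨v, hv⟩ : ∃ v, 2 * d₅ * v = s - d₄ * xs - d₁ * c₂ + s * w :=
      ⟨(s - d₄ * xs - d₁ * c₂ + s * w) / (2 * d₅), by field_simp⟩
    refine exists_SRSolution_family (d := d₁) (s := s) (v := v) (u := c₁ * xs + c₂ * v) hf hlamne
      hlam1 hNopen hNconvex hN0 hF hG hT₀ hys h₁ h₂ h₃' h₄' hm hhom ?_ hsd hs2 inf_le_left hsl
      ?_ ?_ ?_ ?_ ?_
    · intro y
      rw [fderiv_apply_eq_partial, ← hd₁, ← hd₂, hd₂zero]; ring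
    · rw [fderiv_apply_eq_partial, ← hc₁, ← hc₂]; ring
    · rw [fderiv_fderiv_apply_eq_partial hT₂, ← hd₄]
      have e3 : partialX (partialX (fun p => (f^[m] p).2)) (0, ys) = 2 * d₃ := by rw [hd₃]; ring
      have e5 : partialY (partialY (fun p => (f^[m] p).2)) (0, ys) = 2 * d₅ := by rw [hd₅]; ring
      rw [e3, e5]
      simp only
      have hquad : d₅ * v ^ 2 + (d₄ * xs + d₁ * c₂ - s) * v + (d₃ * xs ^ 2 + c₁ * d₁ * xs) = 0 := by
        rw [hcD, hdD, hD] at hΔ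
        refine (mul_eq_zero.1 (?_ : (4 * d₅) * _ = 0)).resolve_left (by simpa using hd₅ne)
        have h4 : (2 * d₅ * v + (d₄ * xs + d₁ * c₂ - s)) ^ 2 = Δ := by
          rw [hv, ← hw]
          linear_combination w ^ 2 * hs2
        rw [hΔ] at h4
        linear_combination h4 + (d₁ * c₂ + d₄ * xs) ^ 2 * hs2 - hs2
      linear_combination s * hquad + v * hs2
    · rw [fderiv_fderiv_apply_eq_partial hT₂, ← hd₄]
      have e5 : partialY (partialY (fun p => (f^[m] p).2)) (0, ys) = 2 * d₅ := by rw [hd₅]; ring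
      rw [e5]
      simp only
      linear_combination s * hv + (1 + w) * hs2
    · rw [fderiv_apply_eq_partial, ← hc₂]; ring
    · intro h; exact hw0 (by linarith)
  have hsq : √Δ ^ 2 = Δ := Real.sq_sqrt hΔpos.le
  have hsqpos : 0 < √Δ := Real.sqrt_pos.2 hΔpos
  -- For w = -√Δ, |trace| < 1 + D reduces to √Δ < 2 (1 + D), which is the upper bound on c₂y*/x*;
  -- the lower bound is D < 1.
  obtain ⟨p, hp, hpSR, hpτ, hpD⟩ := family (-√Δ) (by rw [neg_sq, hsq])
  obtain ⟨q, hq, hqSR, hqτ, hqD⟩ := family (√Δ) hsq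
  rw [hcD] at hstab₁ hstab₂
  have hstable : ∀ᶠ k in l, |planeTrace (fderiv ℝ f^[k + m] (p k))| <
      1 + planeDet (fderiv ℝ f^[k + m] (p k)) ∧ planeDet (fderiv ℝ f^[k + m] (p k)) < 1 :=
    (hpτ.abs.eventually_lt (hpD.const_add 1) (by rw [abs_lt]; constructor <;> linarith)).and
      (hpD.eventually (gt_mem_nhds (by linarith)))
  have hsaddle : ∀ᶠ k in l, 1 + planeDet (fderiv ℝ f^[k + m] (q k)) <
      planeTrace (fderiv ℝ f^[k + m] (q k)) ∧
      0 < 1 + planeTrace (fderiv ℝ f^[k + m] (q k)) + planeDet (fderiv ℝ f^[k + m] (q k)) :=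
    ((hqD.const_add 1).eventually_lt hqτ (by linarith)).and
      (((hqτ.const_add 1).add hqD).eventually (lt_mem_nhds (by linarith)))
  have hfdiff : Differentiable ℝ f := hf.differentiable (by simp)
  classical
  refine ⟨fun k => if (-1 : ℝ) ^ k = s then p k else (xs, 0),
    fun k => if (-1 : ℝ) ^ k = s then q k else (xs, 0),
    Tendsto.if hp tendsto_const_nhds, Tendsto.if hq tendsto_const_nhds, fun η hη => ?_⟩
  have hall := ((hpSR η hη).and (hqSR η hη)).and (hstable.and hsaddle)
  rw [hl, eventually_inf_principal] at hall
  obtain ⟨kmin, hkmin⟩ := eventually_atTop.1 hall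
  refine ⟨kmin, fun k hk hpar => ?_⟩
  have hks := hsk k hpar
  obtain ⟨⟨a1, a2⟩, a3, a4⟩ := hkmin k hk hks
  simp only [hks, if_true]
  have hfixed : ∀ x, IsSRSolution f N η m k x → f^[k + m] x = x := fun x hx => by
    rw [← hx.2.1]; exact Function.iterate_minimalPeriod
  refine ⟨⟨a1, isAsymptoticallyStable_of_jury hfdiff a1.1 (hfixed _ a1) a3.1 a3.2⟩, a2,
    hfixed _ a2, ?_⟩
  obtain ⟨μ, ν, hμ, hν, eμ, eν⟩ := exists_saddle_eigenvalues a4.1 a4.2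
  exact ⟨μ, ν, hμ, hν, hasEigenvalue_plane _ μ eμ, hasEigenvalue_plane _ ν eν⟩
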